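/- Let $\mathcal H$ be a separable infinite-dimensional complex Hilbert space. A symmetrically normed ideal is a two-sided ideal $\mathcal J\subseteq\mathcal B(\mathcal H)$ with a complete norm satisfying $\|axb\|_{\mathcal J}\le\|a\|\,\|x\|_{\mathcal J}\,\|b\|$ for $x\in\mathcal J$, $a,b\in\mathcal B(\mathcal H)$, and equal to $1$ on rank-one orthogonal projections. A pair $(\mathcal J,\mathcal J_1)$ of such ideals is a dual pair if $\mathcal J\mathcal J_1\subseteq\mathfrak S_1(\mathcal H)$ (the trace class) and $(x,y)\mapsto\operatorname{Tr}(xy)$ induces an isometric isomorphism of $\mathcal J$ onto the topological dual of $\mathcal J_1$. Put $U_{\mathcal J}=\{u\in\mathcal B(\mathcal H)\ \text{unitary}\mid u-1\in\mathcal J\}$, topologized by $\|u-v\|_{\mathcal J}$, and $\mathfrak u_{\mathcal J}=\{x\in\mathcal J\mid x^*=-x\}$. For $a\in\mathcal B(\mathcal H)$ put $U_{\mathcal J}(a)=\{u\in U_{\mathcal J}\mid uau^*=a\}$, $\operatorname{Lie}(U_{\mathcal J}(a))=\{x\in\mathfrak u_{\mathcal J}\mid e^{tx}\in U_{\mathcal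 J}(a)\ \text{for all } t\in\mathbb R\}$, and $\mathcal O_{\mathcal J}(a)=\{uau^*\mid u\in U_{\mathcal J}\}$, topologized so that the bijection $U_{\mathcal J}/U_{\mathcal J}(a)\to\mathcal O_{\mathcal J}(a)$, $uU_{\mathcal J}(a)\mapsto uau^*$, is a homeomorphism. Let $(\mathcal J,\mathcal J_1)$ be a dual pair of ideals and $a\in\mathcal B(\mathcal H)$ a normal operator. Then the following hold. (i) There is a bounded real-linear operator $\widetilde E\colon\mathfrak u_{\mathcal J}\to\mathfrak u_{\mathcal J}$ with $\widetilde E^2=\widetilde E$ and $\widetilde E(\mathfrak u_{\mathcal J})=\operatorname{Lie}(U_{\mathcal J}(a))$, so that $\mathfrak u_{\mathcal J}=\operatorname{Lie}(U_{\mathcal J}(a))\oplus\ker\widetilde E$. Moreover $\widetilde E$ can be chosen so that, for some invariant mean $\mu$ on $\ell^\infty(\mathbb R^2)$, $$\operatorname{Tr}(\widetilde E(x)y)=\mu\big((s,t)\mapsto\operatorname{Tr}(\alpha_{s,t}(x)\,y)\big)\qquad(x\in\mathfrak u_{\mathcal J},\ y\in\mathcal J_1),$$ where $\alpha_{s,t}(x)=e^{i(s\operatorname{Re}a+t\operatorname{Im}a)}\,x\,e^{-i(s\operatorname{Re}a+t\operatorname{Im}a)}$,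 $\operatorname{Re}a=\frac{a+a^*}{2}$, $\operatorname{Im}a=\frac{a-a^*}{2i}$, and the functions in the argument of $\mu$ are bounded. (ii) $U_{\mathcal J}$ is a real-analytic Banach–Lie group modelled on $\mathfrak u_{\mathcal J}$, for which $u\mapsto u-1$ is a real-analytic embedding into $\mathcal J$ with tangent space $\mathfrak u_{\mathcal J}$ at $1$; and $U_{\mathcal J}(a)$ is a Banach–Lie subgroup of it: with its subspace topology it is a real-analytic Banach–Lie group modelled on $\operatorname{Lie}(U_{\mathcal J}(a))$, which is also its tangent space at $1$, and the inclusion $U_{\mathcal J}(a)\hookrightarrow U_{\mathcal J}$ is a (split) real-analytic embedding. (iii) For the manifold structure of $U_{\mathcal J}$ in (ii), $\mathcal O_{\mathcal J}(a)$ is a Hausdorff real-analytic Banach manifold modelled on $\ker\widetilde E$ and a homogeneous space of $U_{\mathcal J}$: the transitive action $U_{\mathcal J}\times\mathcal O_{\mathcal J}(a)\to\mathcal O_{\mathcal J}(a)$, $(u,b)\mapsto ubu^*$, is real-analytic (in particular smooth), and $u\mapsto uau^*$ is a real-analytic submersion of $U_{\mathcal J}$ onto $\mathcal O_{\mathcal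 J}(a)$. -/

import Mathlib

open scoped Manifold ContDiff InnerProductSpace ComplexStarModule ENNReal

noncomputable section

/-! ### Trace class operators and the trace -/

/-- An index set of a chosen orthonormal (Hilbert) basis of `H`. -/
def traceIndex (H : Type*) [NormedAddCommGroup H] [InnerProductSpace ℂ H] [CompleteSpace H] :
    Set H :=
  Classical.choose (exists_hilbertBasis ℂ H)

/-- A chosen orthonormal basis of `H`, used to evaluate traces.  (Neither the class of trace class
operators nor the trace of such an operator depends on the choice.) -/
def traceBasis (H : Type*) [NormedAddCommGroup H] [InnerProductSpace ℂ H] [CompleteSpace H] :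
    HilbertBasis (traceIndex H) ℂ H :=
  Classical.choose (Classical.choose_spec (exists_hilbertBasis ℂ H))

/-- `T` belongs to the trace class `𝔖₁(H)`: the positive operator `|T| = (T* T)^{1/2}` satisfies
`∑ᵢ ⟨bᵢ, |T| bᵢ⟩ < ∞`. -/
def IsTraceClass {H : Type*} [NormedAddCommGroup H] [InnerProductSpace ℂ H] [CompleteSpace H]
    (T : H →L[ℂ] H) : Prop :=
  Summable fun i => inner ℂ (traceBasis H i) ((CFC.abs T) (traceBasis H i))

/-- The trace `∑ᵢ ⟨bᵢ, T bᵢ⟩` of a trace class operator. -/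
def opTrace {H : Type*} [NormedAddCommGroup H] [InnerProductSpace ℂ H] [CompleteSpace H]
    (T : H →L[ℂ] H) : ℂ :=
  ∑' i, inner ℂ (traceBasis H i) (T (traceBasis H i))

/-! ### Symmetrically normed ideals -/

/-- A symmetrically normed ideal of `B(H)`: a two-sided ideal with a complete norm satisfying
`‖a x b‖_J ≤ ‖a‖ ‖x‖_J ‖b‖`, normalized to be `1` on the rank-one orthogonal projections. -/
structure SymmNormedIdeal (H : Type*) [NormedAddCommGroup H] [InnerProductSpace ℂ H] where
  carrier : Submodule ℂ (H →L[ℂ] H)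
  mul_mem : ∀ (a b : H →L[ℂ] H) {x : H →L[ℂ] H}, x ∈ carrier → a * x * b ∈ carrier
  idealNorm : carrier → ℝ
  idealNorm_nonneg : ∀ x, 0 ≤ idealNorm x
  idealNorm_eq_zero_iff : ∀ x, idealNorm x = 0 ↔ x = 0
  idealNorm_smul : ∀ (c : ℂ) (x), idealNorm (c • x) = ‖c‖ * idealNorm x
  idealNorm_add_le : ∀ x y, idealNorm (x + y) ≤ idealNorm x + idealNorm y
  idealNorm_mul_le : ∀ (a b : H →L[ℂ] H) (x : carrier),
    idealNorm ⟨a * x * b, mul_mem a b x.2⟩ ≤ ‖a‖ * idealNorm x * ‖b‖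
  /-- Every Cauchy sequence converges. -/
  complete : ∀ u : ℕ → carrier,
    (∀ ε > 0, ∃ N, ∀ m ≥ N, ∀ n ≥ N, idealNorm (u m - u n) < ε) →
      ∃ x, ∀ ε > 0, ∃ N, ∀ n ≥ N, idealNorm (u n - x) < ε
  idealNorm_rankOne : ∀ (ξ : H) (h : InnerProductSpace.rankOne ℂ ξ ξ ∈ carrier), ‖ξ‖ = 1 →
    idealNorm ⟨InnerProductSpace.rankOne ℂ ξ ξ, h⟩ = 1

namespace SymmNormedIdeal

section Basic

variable {H : Type*} [NormedAddCommGroup H] [InnerProductSpace ℂ H]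

/-- The ideal `J` as a Banach space with its own norm `‖·‖_J` (not the operator norm). -/
def Elem (J : SymmNormedIdeal H) : Type _ := J.carrier

instance (J : SymmNormedIdeal H) : AddCommGroup J.Elem := inferInstanceAs (AddCommGroup J.carrier)

instance (J : SymmNormedIdeal H) : Module ℂ J.Elem := inferInstanceAs (Module ℂ J.carrier)

instance (J : SymmNormedIdeal H) : Norm J.Elem := ⟨J.idealNorm⟩

theorem normCore (J : SymmNormedIdeal H) : NormedSpace.Core ℂ J.Elem where
  norm_nonneg := J.idealNorm_nonneg
  norm_smul := J.idealNorm_smul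
  norm_triangle := J.idealNorm_add_le
  norm_eq_zero_iff := J.idealNorm_eq_zero_iff

instance (J : SymmNormedIdeal H) : NormedAddCommGroup J.Elem := NormedAddCommGroup.ofCore J.normCore

instance (J : SymmNormedIdeal H) : NormedSpace ℂ J.Elem := NormedSpace.ofCore J.normCore

instance (J : SymmNormedIdeal H) : CompleteSpace J.Elem := by
  refine Metric.complete_of_cauchySeq_tendsto fun u hu => ?_
  rw [Metric.cauchySeq_iff] at hu
  have hd : ∀ x y : J.Elem, dist x y = J.idealNorm (x - y) := fun x y => dist_eq_norm x y
  simp only [hd] at hu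
  obtain ⟨x, hx⟩ := J.complete u hu
  refine ⟨x, Metric.tendsto_atTop.2 fun ε hε => ?_⟩
  obtain ⟨N, hN⟩ := hx ε hε
  exact ⟨N, fun n hn => (hd (u n) x).trans_lt (hN n hn)⟩

/-- The operator underlying an element of `J`. -/
def toOp (J : SymmNormedIdeal H) : J.Elem →ₗ[ℂ] (H →L[ℂ] H) := J.carrier.subtype

/-- `(J, J₁)` is a dual pair of ideals: `J J₁ ⊆ 𝔖₁(H)`, and `(x, y) ↦ Tr (x y)` induces an isometric
isomorphism of `J` onto the topological dual of `J₁`. -/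
def IsDualPair [CompleteSpace H] (J J₁ : SymmNormedIdeal H) : Prop :=
  (∀ x ∈ J.carrier, ∀ y ∈ J₁.carrier, IsTraceClass (x * y)) ∧
    ∃ D : J.Elem ≃ₗᵢ[ℂ] StrongDual ℂ J₁.Elem,
      ∀ (x : J.Elem) (y : J₁.Elem), D x y = opTrace (J.toOp x * J₁.toOp y)

end Basic

variable {H : Type*} [NormedAddCommGroup H] [InnerProductSpace ℂ H] [CompleteSpace H]

/-! ### The unitary group `U_J` and its Lie algebra `𝔲_J` -/

/-- `𝔲_J = {x ∈ J | x* = -x}`, a real subspace of `J` with the norm `‖·‖_J`. -/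
def lieAlg (J : SymmNormedIdeal H) : Submodule ℝ J.Elem where
  carrier := {x | star (J.toOp x) = -J.toOp x}
  add_mem' {x y} hx hy := by
    simp only [Set.mem_ofPred_eq] at *
    rw [map_add, star_add, hx, hy, neg_add]
  zero_mem' := by
    change star (J.toOp 0) = -J.toOp 0
    simp
  smul_mem' c x hx := by
    simp only [Set.mem_ofPred_eq] at *
    have h : J.toOp (c • x) = (c : ℂ) • J.toOp x := J.toOp.map_smul (c : ℂ) x
    rw [h, star_smul, hx]
    simp

/-- `(1 + J) ∩ U(H)` as a group of unitary operators. -/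
def unitarySubgroup (J : SymmNormedIdeal H) : Subgroup (unitary (H →L[ℂ] H)) where
  carrier := {u | (u : H →L[ℂ] H) - 1 ∈ J.carrier}
  one_mem' := by simp
  mul_mem' {u v} hu hv := by
    simp only [Set.mem_ofPred_eq] at *
    have h : ((u * v : unitary (H →L[ℂ] H)) : H →L[ℂ] H) - 1
        = u * ((v : H →L[ℂ] H) - 1) * 1 + ((u : H →L[ℂ] H) - 1) := by
      rw [Submonoid.coe_mul]; noncomm_ring
    rw [h]
    exact J.carrier.add_mem (J.mul_mem _ _ hv) hu
  inv_mem' {u} hu := by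
    simp only [Set.mem_ofPred_eq] at *
    have h : ((u⁻¹ : unitary (H →L[ℂ] H)) : H →L[ℂ] H) - 1
        = -(((u⁻¹ : unitary (H →L[ℂ] H)) : H →L[ℂ] H) * ((u : H →L[ℂ] H) - 1) * 1) := by
      have h1 : ((u⁻¹ : unitary (H →L[ℂ] H)) : H →L[ℂ] H) * (u : H →L[ℂ] H) = 1 := by
        rw [← Submonoid.coe_mul, inv_mul_cancel, Submonoid.coe_one]
      rw [mul_one, mul_sub, h1, mul_one, neg_sub]
    rw [h]
    exact J.carrier.neg_mem (J.mul_mem _ _ hu)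

/-- The group `U_J = (1 + J) ∩ U(H)`, to be topologized by the norm of `J`. -/
def UGroup (J : SymmNormedIdeal H) : Type _ := J.unitarySubgroup

instance (J : SymmNormedIdeal H) : Group J.UGroup := inferInstanceAs (Group J.unitarySubgroup)

/-- The operator underlying an element of `U_J`. -/
def UGroup.toOp {J : SymmNormedIdeal H} (u : J.UGroup) : H →L[ℂ] H := u.1.1

/-- The map `U_J → J`, `u ↦ u - 1`. -/
def UGroup.subOne {J : SymmNormedIdeal H} (u : J.UGroup) : J.Elem := ⟨u.toOp - 1, u.2⟩

/-- The topology of `U_J`: the one given by the distance `‖u - v‖_J`. -/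
instance (J : SymmNormedIdeal H) : TopologicalSpace J.UGroup :=
  TopologicalSpace.induced UGroup.subOne inferInstance

/-- The action `u • b = u b u*` of `U_J` on `B(H)`. -/
instance (J : SymmNormedIdeal H) : MulAction J.UGroup (H →L[ℂ] H) where
  smul u b := u.toOp * b * star u.toOp
  one_smul b := by
    change (1 : H →L[ℂ] H) * b * star (1 : H →L[ℂ] H) = b
    simp
  mul_smul u v b := by
    change (u.toOp * v.toOp) * b * star (u.toOp * v.toOp)
      = u.toOp * (v.toOp * b * star v.toOp) * star u.toOp
    rw [star_mul]
    noncomm_ring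

/-! ### The isotropy group `U_J(a)`, its Lie algebra, and the orbit `O_J(a)` -/

/-- `U_J(a) = {u ∈ U_J | u a u* = a}`. -/
abbrev isotropy (J : SymmNormedIdeal H) (a : H →L[ℂ] H) : Subgroup J.UGroup :=
  MulAction.stabilizer J.UGroup a

/-- The Lie algebra `{x ∈ 𝔲_J | exp (t x) ∈ K for all t ∈ ℝ}` of a subgroup `K` of `U_J`, as a
set. -/
def lieSet (J : SymmNormedIdeal H) (K : Subgroup J.UGroup) : Set J.lieAlg :=
  {x | ∀ t : ℝ, ∃ u ∈ K, u.toOp = NormedSpace.exp (t • J.toOp x)}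

theorem exp_sub_one_mem (J : SymmNormedIdeal H) {x : H →L[ℂ] H} (hx : x ∈ J.carrier) :
    NormedSpace.exp x - 1 ∈ J.carrier := by
  have hs := NormedSpace.exp_series_hasSum_exp' (𝕂 := ℂ) x
  have hs' : Summable fun n : ℕ => ((n + 1).factorial⁻¹ : ℂ) • x ^ n := by
    refine Summable.of_norm_bounded (NormedSpace.norm_expSeries_summable' (𝕂 := ℂ) x) fun n => ?_
    rw [norm_smul, norm_smul]
    gcongr
    rw [norm_inv, norm_inv, Complex.norm_natCast, Complex.norm_natCast]
    gcongr
    omega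
  have h1 := (hasSum_nat_add_iff' 1).2 hs
  have h2 := hs'.hasSum.mul_left x
  have h3 : NormedSpace.exp x - 1 = 1 * x * ∑' n : ℕ, ((n + 1).factorial⁻¹ : ℂ) • x ^ n := by
    rw [one_mul]
    refine HasSum.unique ?_ h2
    simpa [pow_succ'] using h1
  rw [h3]
  exact J.mul_mem _ _ hx

theorem mem_lieSet_isotropy_iff (J : SymmNormedIdeal H) (a : H →L[ℂ] H) (x : J.lieAlg) :
    x ∈ J.lieSet (J.isotropy a) ↔ J.toOp x * a = a * J.toOp x := by
  have hsmul : ∀ u : J.UGroup, u ∈ J.isotropy a ↔ u.toOp * a = a * u.toOp := by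
    intro u
    have h1 : star u.toOp * u.toOp = 1 := Unitary.star_mul_self_of_mem u.1.2
    have h2 : u.toOp * star u.toOp = 1 := Unitary.mul_star_self_of_mem u.1.2
    rw [MulAction.mem_stabilizer_iff]
    change u.toOp * a * star u.toOp = a ↔ _
    constructor
    · intro h
      calc u.toOp * a = u.toOp * a * (star u.toOp * u.toOp) := by rw [h1, mul_one]
        _ = (u.toOp * a * star u.toOp) * u.toOp := by noncomm_ring
        _ = a * u.toOp := by rw [h]
    · intro h
      rw [h, mul_assoc, h2, mul_one]
  constructor
  · intro h
    have hc : ∀ t : ℝ, NormedSpace.exp (t • J.toOp x) * a = a * NormedSpace.exp (t • J.toOp x) := by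
      intro t
      obtain ⟨u, hu, hu'⟩ := h t
      rw [← hu']
      exact (hsmul u).1 hu
    have hd := hasDerivAt_exp_smul_const (𝕂 := ℝ) (J.toOp x) (0 : ℝ)
    have hl := hd.mul_const a
    have hr := hd.const_mul a
    rw [funext hc] at hl
    simpa using hl.unique hr
  · intro h t
    have hx : star (J.toOp x) = -J.toOp x := x.2
    have hu : NormedSpace.exp (t • J.toOp x) ∈ unitary (H →L[ℂ] H) := by
      have hskew : t • J.toOp x ∈ skewAdjoint (H →L[ℂ] H) := by
        rw [skewAdjoint.mem_iff, star_smul, hx]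
        simp
      let _ : NormedAlgebra ℚ (H →L[ℂ] H) := NormedAlgebra.restrictScalars ℚ ℝ (H →L[ℂ] H)
      rw [Unitary.mem_iff, NormedSpace.star_exp, skewAdjoint.mem_iff.1 hskew]
      constructor
      · rw [← NormedSpace.exp_add_of_commute (Commute.neg_left (Commute.refl _))]
        simp
      · rw [← NormedSpace.exp_add_of_commute (Commute.neg_right (Commute.refl _))]
        simp
    have hJ : t • J.toOp x ∈ J.carrier :=
      J.carrier.smul_mem (t : ℂ) (Subtype.property (p := (· ∈ J.carrier)) (x : J.Elem))
    refine ⟨⟨⟨_, hu⟩, J.exp_sub_one_mem hJ⟩, (hsmul _).2 ?_, rfl⟩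
    exact ((show Commute (J.toOp x) a from h).smul_left t).exp_left

/-- The Lie algebra `{x ∈ 𝔲_J | exp (t x) ∈ U_J(a) for all t ∈ ℝ}` of `U_J(a)`, as a real
subspace of `𝔲_J`. -/
def isotropyLieAlg (J : SymmNormedIdeal H) (a : H →L[ℂ] H) : Submodule ℝ J.lieAlg where
  carrier := J.lieSet (J.isotropy a)
  add_mem' {x y} hx hy := by
    rw [mem_lieSet_isotropy_iff] at *
    simp only [Submodule.coe_add, map_add, add_mul, mul_add, hx, hy]
  zero_mem' := by
    rw [mem_lieSet_isotropy_iff]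
    simp
  smul_mem' c x hx := by
    rw [mem_lieSet_isotropy_iff] at *
    have h : J.toOp ((c • x : J.lieAlg) : J.Elem) = (c : ℂ) • J.toOp x :=
      J.toOp.map_smul (c : ℂ) (x : J.Elem)
    rw [h, smul_mul_assoc, hx, mul_smul_comm]

/-- The orbit `O_J(a) = {u a u* | u ∈ U_J}`, to be topologized as `U_J / U_J(a)` (and not as a
subspace of `B(H)`). -/
def Orbit (J : SymmNormedIdeal H) (a : H →L[ℂ] H) : Type _ := MulAction.orbit J.UGroup a

/-- The action `A(u, b) = u b u*` of `U_J` on `O_J(a)`. -/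
instance (J : SymmNormedIdeal H) (a : H →L[ℂ] H) : MulAction J.UGroup (J.Orbit a) :=
  inferInstanceAs (MulAction J.UGroup (MulAction.orbit J.UGroup a))

/-- The map `U_J → O_J(a)`, `u ↦ u a u*`. -/
def orbitMap (J : SymmNormedIdeal H) (a : H →L[ℂ] H) (u : J.UGroup) : J.Orbit a :=
  ⟨u • a, MulAction.mem_orbit a u⟩

/-- The quotient topology, for which the bijection `U_J / U_J(a) → O_J(a)` is a homeomorphism. -/
instance (J : SymmNormedIdeal H) (a : H →L[ℂ] H) : TopologicalSpace (J.Orbit a) :=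
  TopologicalSpace.coinduced (J.orbitMap a) inferInstance

end SymmNormedIdeal

/-! ### Averaging -/

/-- An invariant mean on `ℓ^∞(S)`: a bounded linear functional that is positive, is `1` on the
constant function `1`, and is invariant under translations. -/
structure IsInvariantMean {S : Type*} [Add S] (μ : lp (fun _ : S => ℂ) ∞ →L[ℂ] ℂ) : Prop where
  nonneg : ∀ f : lp (fun _ : S => ℂ) ∞, (∀ s, 0 ≤ (f s).re ∧ (f s).im = 0) →
    0 ≤ (μ f).re ∧ (μ f).im = 0
  one : ∀ f : lp (fun _ : S => ℂ) ∞, (∀ s, f s = 1) → μ f = 1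
  translate : ∀ (t : S) (f g : lp (fun _ : S => ℂ) ∞), (∀ s, g s = f (t + s)) → μ g = μ f

/-- `exp (i (s Re a + t Im a)) x exp (-i (s Re a + t Im a))`, where `Re a = (a + a*) / 2` and
`Im a = (a - a*) / (2 i)`. -/
def conjFlow {H : Type*} [NormedAddCommGroup H] [InnerProductSpace ℂ H] [CompleteSpace H]
    (a : H →L[ℂ] H) (p : ℝ × ℝ) (x : H →L[ℂ] H) : H →L[ℂ] H :=
  NormedSpace.exp (Complex.I • (p.1 • (ℜ a : H →L[ℂ] H) + p.2 • (ℑ a : H →L[ℂ] H))) * x *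
    NormedSpace.exp (-(Complex.I • (p.1 • (ℜ a : H →L[ℂ] H) + p.2 • (ℑ a : H →L[ℂ] H))))

/-- `E` is obtained on `𝔲_J ⊆ J ≅ J₁*` by averaging the operators `conjFlow a p`, `p ∈ ℝ²`, with the
mean `μ`: `Tr (E(x) y) = μ (p ↦ Tr (conjFlow a p x · y))`, the function being bounded. -/
def IsAverage {H : Type*} [NormedAddCommGroup H] [InnerProductSpace ℂ H] [CompleteSpace H]
    (J J₁ : SymmNormedIdeal H) (a : H →L[ℂ] H) (μ : lp (fun _ : ℝ × ℝ => ℂ) ∞ →L[ℂ] ℂ)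
    (E : J.lieAlg →L[ℝ] J.lieAlg) : Prop :=
  ∀ (x : J.lieAlg) (y : J₁.Elem), ∃ f : lp (fun _ : ℝ × ℝ => ℂ) ∞,
    (∀ p, f p = opTrace (conjFlow a p (J.toOp x) * J₁.toOp y)) ∧
      opTrace (J.toOp (E x) * J₁.toOp y) = μ f

end

/-! Part (i) is amenability. A skew-adjoint `x` in `J` commutes with `a` exactly when it is fixed by
conjugation with all the unitaries `exp (i (s Re a + t Im a))`. Normality of `a` makes this
conjugation an isometric action of the abelian group `ℝ²` on `J`. Since `J` is the dual of `J₁`,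
orbits can be averaged weak-*: for an invariant mean `μ`, the functional `y ↦ μ (p ↦ Tr (α_p(x) y))`
is bounded on `J₁`, hence is `Tr (E(x) ·)` for a unique `E(x)` in `J`. Invariance of `μ` makes
`E(x)` a fixed point, fixed points are left alone, and a positive mean respects complex conjugation,
so `E` preserves skew-adjointness. Thus `E` is a bounded projection onto the Lie algebra of the
isotropy group (`exists_expectation`).

For (ii), write `u = 1 + w` and use the Cayley transform `w ↦ w (2 + w)⁻¹ = (u - 1)(u + 1)⁻¹`, a
local analytic change of coordinates of `J`. It is skew-adjoint iff `u` is unitary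
(`mem_range_subOne_iff`), and commutes with `a` iff `w` does (`commute_cayley_iff`). So one family
of ambient charts, moved around by left translations, straightens `U_J` to `𝔲_J` and `U_J(a)` to its
Lie algebra, which `E` complements. `SliceData` turns such charts into embedded manifolds. The group
operations are restrictions of analytic maps of `J`, hence analytic.

For (iii), let `c` be the inverse Cayley chart at `1`, defined on all of `𝔲_J`. The map `(k, l) ↦
c(k) c(l)`, with `k` in `ker E` and `l` in the Lie algebra of the isotropy group, has invertible
derivative at `0`. The inverse function theorem gives coordinates near `1` in which the cosets of
`U_J(a)` are the sets of constant `k` (`exists_cosetSlice`). Thus `k` is a coordinate on the orbit,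
its translates form an analytic atlas, and the orbit map becomes the projection `(k, l) ↦ k`. -/

open scoped Manifold ContDiff InnerProductSpace ComplexStarModule ENNReal

noncomputable section

/-! ### Existence of invariant means on commutative groups -/

section InvariantMean

open Filter Topology

/-- A mean on `ℓ^∞(S)`: a norm-decreasing positive unital functional. -/
structure IsMean {S : Type*} (μ : lp (fun _ : S => ℂ) ∞ →L[ℂ] ℂ) : Prop where
  norm_le : ∀ f, ‖μ f‖ ≤ ‖f‖
  nonneg : ∀ f : lp (fun _ : S => ℂ) ∞, (∀ s, 0 ≤ (f s).re ∧ (f s).im = 0) →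
    0 ≤ (μ f).re ∧ (μ f).im = 0
  one : ∀ f : lp (fun _ : S => ℂ) ∞, (∀ s, f s = 1) → μ f = 1

/-- A function with a uniform bound, as an element of `ℓ^∞`. -/
def lpInftyMk {S : Type*} (f : S → ℂ) (C : ℝ) (h : ∀ s, ‖f s‖ ≤ C) : lp (fun _ : S => ℂ) ∞ :=
  ⟨f, memℓp_infty ⟨C, by rintro _ ⟨s, rfl⟩; exact h s⟩⟩

theorem norm_lpInftyMk_le {S : Type*} (f : S → ℂ) {C : ℝ} (h : ∀ s, ‖f s‖ ≤ C) (hC : 0 ≤ C) :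
    ‖lpInftyMk f C h‖ ≤ C :=
  lp.norm_le_of_forall_le hC h

/-- Translation on `ℓ^∞(S)`. -/
def lpTranslate {S : Type*} [Add S] (t : S) (f : lp (fun _ : S => ℂ) ∞) :
    lp (fun _ : S => ℂ) ∞ :=
  lpInftyMk (fun s => f (t + s)) ‖f‖ fun _ => lp.norm_apply_le_norm (by simp) f _

theorem norm_lpTranslate_le {S : Type*} [Add S] (t : S) (f : lp (fun _ : S => ℂ) ∞) :
    ‖lpTranslate t f‖ ≤ ‖f‖ :=
  norm_lpInftyMk_le _ _ (norm_nonneg _)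

/-- Weak-* compactness of the set of means: for each `f` the values stay in the compact disc of
radius `‖f‖`, so they converge along an ultrafilter, and all defining conditions of a mean are
closed. -/
theorem exists_isMean_tendsto {S ι : Type*} (U : Ultrafilter ι)
    (m : ι → lp (fun _ : S => ℂ) ∞ →L[ℂ] ℂ) (hm : ∀ i, IsMean (m i)) :
    ∃ μ : lp (fun _ : S => ℂ) ∞ →L[ℂ] ℂ, IsMean μ ∧
      ∀ f, Tendsto (fun i => m i f) U (𝓝 (μ f)) := by
  have hlim : ∀ f, ∃ z, Tendsto (fun i => m i f) U (𝓝 z) := by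
    intro f
    have hc := isCompact_closedBall (0 : ℂ) ‖f‖
    obtain ⟨z, -, hz⟩ := hc.ultrafilter_le_nhds (U.map fun i => m i f) (by
      rw [Ultrafilter.coe_map, le_principal_iff, mem_map]
      exact univ_mem' fun i => by simpa using (hm i).norm_le f)
    exact ⟨z, hz⟩
  choose L hL using hlim
  have hn : ∀ f, ‖L f‖ ≤ ‖f‖ := fun f =>
    le_of_tendsto (hL f).norm (univ_mem' fun i => (hm i).norm_le f)
  let μ : lp (fun _ : S => ℂ) ∞ →L[ℂ] ℂ := LinearMap.mkContinuous
    { toFun := L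
      map_add' := fun f g => tendsto_nhds_unique (hL (f + g)) (by
        simpa using (hL f).add (hL g))
      map_smul' := fun c f => tendsto_nhds_unique (hL (c • f)) (by
        simpa using (hL f).const_mul c) } 1 (by simpa using hn)
  have hμ : ∀ f, μ f = L f := fun _ => rfl
  refine ⟨μ, ⟨hn, fun f hf => ⟨?_, ?_⟩, fun f hf => ?_⟩, hL⟩
  · exact ge_of_tendsto (Complex.continuous_re.continuousAt.tendsto.comp (hL f))
      (univ_mem' fun i => ((hm i).nonneg f hf).1)
  · refine tendsto_nhds_unique (Complex.continuous_im.continuousAt.tendsto.comp (hL f)) ?_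
    refine tendsto_const_nhds.congr fun i => ?_
    exact (((hm i).nonneg f hf).2).symm
  · refine tendsto_nhds_unique (hL f) (tendsto_const_nhds.congr fun i => ?_)
    exact ((hm i).one f hf).symm

theorem exists_isMean {S : Type*} [Nonempty S] :
    ∃ μ : lp (fun _ : S => ℂ) ∞ →L[ℂ] ℂ, IsMean μ := by
  obtain ⟨s⟩ := ‹Nonempty S›
  refine ⟨LinearMap.mkContinuous
    { toFun := fun f => f s
      map_add' := fun f g => rfl
      map_smul' := fun c f => rfl } 1 fun f => ?_, fun f => ?_, fun f hf => hf s, fun f hf => hf s⟩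
  · rw [one_mul]
    exact lp.norm_apply_le_norm (by simp) f s
  · exact lp.norm_apply_le_norm (by simp) f s

/-- The average of the first `n + 1` translates of a functional. -/
def translateAverage {S : Type*} [AddCommGroup S] (μ : lp (fun _ : S => ℂ) ∞ →L[ℂ] ℂ) (t : S)
    (n : ℕ) (f : lp (fun _ : S => ℂ) ∞) : ℂ :=
  ((n : ℂ) + 1)⁻¹ * ∑ k ∈ Finset.range (n + 1), μ (lpTranslate (k • t) f)

theorem exists_isMean_translateAverage {S : Type*} [AddCommGroup S]
    {μ : lp (fun _ : S => ℂ) ∞ →L[ℂ] ℂ} (hμ : IsMean μ) (t : S) (n : ℕ) :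
    ∃ ν : lp (fun _ : S => ℂ) ∞ →L[ℂ] ℂ, IsMean ν ∧ ∀ f, ν f = translateAverage μ t n f := by
  have hpos : (0 : ℝ) < (n : ℝ) + 1 := by positivity
  have hne : ((n : ℂ) + 1) ≠ 0 := by exact_mod_cast hpos.ne'
  have hinv : ((n : ℂ) + 1)⁻¹ = ((((n : ℝ) + 1)⁻¹ : ℝ) : ℂ) := by push_cast; rfl
  have hn : ∀ f, ‖translateAverage μ t n f‖ ≤ ‖f‖ := by
    intro f
    rw [translateAverage, norm_mul, hinv, Complex.norm_real, Real.norm_of_nonneg (by positivity),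
      inv_mul_le_iff₀ hpos]
    refine (norm_sum_le _ _).trans ?_
    refine (Finset.sum_le_card_nsmul _ _ ‖f‖ fun k _ =>
      (hμ.norm_le _).trans (norm_lpTranslate_le _ _)).trans ?_
    simp
  refine ⟨LinearMap.mkContinuous
    { toFun := translateAverage μ t n
      map_add' := fun f g => ?_
      map_smul' := fun c f => ?_ } 1 (by simpa using hn), ⟨hn, fun f hf => ?_, fun f hf => ?_⟩,
      fun f => rfl⟩
  · have : ∀ k : ℕ, lpTranslate (k • t) (f + g) = lpTranslate (k • t) f + lpTranslate (k • t) g :=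
      fun k => rfl
    simp only [translateAverage, this, map_add, Finset.sum_add_distrib, mul_add]
  · have : ∀ k : ℕ, lpTranslate (k • t) (c • f) = c • lpTranslate (k • t) f := fun k => rfl
    simp only [translateAverage, this, map_smul, smul_eq_mul, RingHom.id_apply, ← Finset.mul_sum]
    ring
  · change 0 ≤ (translateAverage μ t n f).re ∧ (translateAverage μ t n f).im = 0
    have h := fun k : ℕ => hμ.nonneg (lpTranslate (k • t) f) fun s => hf _
    rw [translateAverage, hinv, Complex.re_ofReal_mul, Complex.im_ofReal_mul, Complex.re_sum,
      Complex.im_sum]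
    exact ⟨mul_nonneg (by positivity) (Finset.sum_nonneg fun k _ => (h k).1), by simp [h]⟩
  · change translateAverage μ t n f = 1
    have h := fun k : ℕ => hμ.one (lpTranslate (k • t) f) fun s => hf _
    simp only [translateAverage, h]
    simp [hne]

/-- Markov–Kakutani by induction: Cesàro averages of a mean along the multiples of `t` become
`t`-invariant in the limit and, translations commuting, retain the invariance already achieved. -/
theorem exists_isMean_invariant_finset {S : Type*} [AddCommGroup S] (F : Finset S) :
    ∃ μ : lp (fun _ : S => ℂ) ∞ →L[ℂ] ℂ, IsMean μ ∧
      ∀ t ∈ F, ∀ f, μ (lpTranslate t f) = μ f := by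
  classical
  induction F using Finset.induction_on with
  | empty =>
    obtain ⟨μ, hμ⟩ := exists_isMean (S := S)
    exact ⟨μ, hμ, by simp⟩
  | insert t F _ ih =>
    obtain ⟨μ, hμ, hF⟩ := ih
    choose ν hν hνf using exists_isMean_translateAverage hμ t
    obtain ⟨κ, hκ, hlim⟩ := exists_isMean_tendsto (Ultrafilter.of atTop) ν hν
    have hcomm : ∀ (r s : S) f, lpTranslate r (lpTranslate s f)
        = lpTranslate s (lpTranslate r f) := by
      intro r s f
      refine lp.ext (funext fun q => ?_)
      exact congrArg (fun q => f q) (by abel : s + (r + q) = r + (s + q))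
    refine ⟨κ, hκ, fun r hr f => ?_⟩
    rcases Finset.mem_insert.1 hr with rfl | hr
    -- The two averages differ by a telescoping sum, of which only the two end terms survive, each
    -- at most `‖f‖`.
    · have key : ∀ n, ‖ν n (lpTranslate r f) - ν n f‖ ≤ ((n : ℝ) + 1)⁻¹ * (2 * ‖f‖) := by
        intro n
        have hs : ∀ k : ℕ, lpTranslate (k • r) (lpTranslate r f) = lpTranslate ((k + 1) • r) f := by
          intro k
          refine lp.ext (funext fun q => ?_)
          exact congrArg (fun q => f q)
            (by rw [succ_nsmul]; abel : r + (k • r + q) = (k + 1) • r + q)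
        rw [hνf, hνf, translateAverage, translateAverage, ← mul_sub, ← Finset.sum_sub_distrib]
        simp only [hs]
        rw [Finset.sum_range_sub (fun k => μ (lpTranslate (k • r) f)), norm_mul]
        have h1 : ‖((n : ℂ) + 1)⁻¹‖ = ((n : ℝ) + 1)⁻¹ := by
          rw [norm_inv]; norm_cast
        rw [h1]
        gcongr
        refine (norm_sub_le _ _).trans ?_
        have h2 := fun k : ℕ => (hμ.norm_le _).trans (norm_lpTranslate_le (k • r) f)
        linarith [h2 (n + 1), h2 0]
      have h0 : Tendsto (fun n => ν n (lpTranslate r f) - ν n f)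
          (Ultrafilter.of (atTop : Filter ℕ)) (𝓝 0) := by
        refine Tendsto.mono_left ?_ (Ultrafilter.of_le _)
        refine squeeze_zero_norm key ?_
        have := (tendsto_one_div_add_atTop_nhds_zero_nat (𝕜 := ℝ)).mul_const (2 * ‖f‖)
        simpa using this
      exact sub_eq_zero.1 (tendsto_nhds_unique ((hlim _).sub (hlim _)) h0)
    · refine tendsto_nhds_unique (hlim _) ((hlim f).congr fun n => ?_)
      rw [hνf, hνf, translateAverage, translateAverage]
      congr 1
      refine Finset.sum_congr rfl fun k _ => ?_
      rw [hcomm, hF r hr]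

/-- A limit along an ultrafilter finer than the order filter on finite subsets: any given `t`
eventually belongs to the finite set. -/
theorem exists_isInvariantMean (S : Type*) [AddCommGroup S] :
    ∃ μ : lp (fun _ : S => ℂ) ∞ →L[ℂ] ℂ, IsInvariantMean μ := by
  choose ν hν hνF using exists_isMean_invariant_finset (S := S)
  obtain ⟨κ, hκ, hlim⟩ := exists_isMean_tendsto (Ultrafilter.of atTop) ν hν
  refine ⟨κ, hκ.nonneg, hκ.one, fun t f g hg => ?_⟩
  obtain rfl : g = lpTranslate t f := lp.ext (funext hg)
  refine tendsto_nhds_unique (hlim _) ((hlim f).congr' ?_)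
  refine (Ultrafilter.of_le _) ?_
  filter_upwards [eventually_ge_atTop ({t} : Finset S)] with F hF
  exact (hνF F t (by simpa using hF) f).symm

/-- Positivity applied to `‖f‖ - f`, whose mean is `‖f‖ - μ f`. -/
theorem IsInvariantMean.im_eq_zero {S : Type*} [Add S] {μ : lp (fun _ : S => ℂ) ∞ →L[ℂ] ℂ}
    (hμ : IsInvariantMean μ) (f : lp (fun _ : S => ℂ) ∞) (hf : ∀ s, (f s).im = 0) :
    (μ f).im = 0 := by
  have hone : ∀ s : S, ‖(1 : ℂ)‖ ≤ 1 := by simp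
  let e := lpInftyMk (fun _ : S => (1 : ℂ)) 1 hone
  have he : μ e = 1 := hμ.one e fun _ => rfl
  have h := (hμ.nonneg ((‖f‖ : ℂ) • e - f) fun s => ?_).2
  · simpa [he] using h
  · have h1 : ((‖f‖ : ℂ) • e - f) s = (‖f‖ : ℂ) - f s := by
      change (‖f‖ : ℂ) • (1 : ℂ) - f s = _
      simp
    rw [h1]
    have h2 := lp.norm_apply_le_norm (by simp) f s
    have h3 := Complex.re_le_norm (f s)
    simp [hf]
    linarith

/-- The functions `f + g` and `i (f - g)` are real-valued, so their means are real. This is what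
lets averaging commute with the adjoint. -/
theorem IsInvariantMean.map_conj {S : Type*} [Add S] {μ : lp (fun _ : S => ℂ) ∞ →L[ℂ] ℂ}
    (hμ : IsInvariantMean μ) (f g : lp (fun _ : S => ℂ) ∞)
    (h : ∀ s, g s = (starRingEnd ℂ) (f s)) : μ g = (starRingEnd ℂ) (μ f) := by
  have h1 := hμ.im_eq_zero (f + g) fun s => by
    change (f s + g s).im = 0
    simp [h]
  have h2 := hμ.im_eq_zero (Complex.I • (f - g)) fun s => by
    change (Complex.I • (f s - g s)).im = 0
    simp [h]
  simp at h1 h2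
  apply Complex.ext
  · simp; linarith
  · simp; linarith

end InvariantMean

/-! ### Polar decomposition -/

section Polar

variable {H : Type*} [NormedAddCommGroup H] [InnerProductSpace ℂ H] [CompleteSpace H]

theorem norm_cfcAbs_apply (x : H →L[ℂ] H) (ξ : H) : ‖CFC.abs x ξ‖ = ‖x ξ‖ := by
  have hsa : star (CFC.abs x) = CFC.abs x := (IsSelfAdjoint.of_nonneg (CFC.abs_nonneg x)).star_eq
  have h1 : inner ℂ (CFC.abs x ξ) (CFC.abs x ξ) = inner ℂ (x ξ) (x ξ) := by
    rw [← ContinuousLinearMap.adjoint_inner_right, ← ContinuousLinearMap.adjoint_inner_right,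
      ← ContinuousLinearMap.star_eq_adjoint, ← ContinuousLinearMap.star_eq_adjoint, hsa,
      ← mul_apply_eq_comp, ← mul_apply_eq_comp, CFC.abs_mul_abs]
  rw [inner_self_eq_norm_sq_to_K, inner_self_eq_norm_sq_to_K] at h1
  have h2 : ‖CFC.abs x ξ‖ ^ 2 = ‖x ξ‖ ^ 2 := by exact_mod_cast h1
  exact (sq_eq_sq₀ (norm_nonneg _) (norm_nonneg _)).1 h2

/-- The polar decomposition `x = v |x|`, together with `v* x = |x|`. -/
theorem exists_polarDecomposition (x : H →L[ℂ] H) :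
    ∃ v : H →L[ℂ] H, ‖v‖ ≤ 1 ∧ v * CFC.abs x = x ∧ star v * x = CFC.abs x := by
  let A := CFC.abs x
  let K : Submodule ℂ H := (LinearMap.range (A : H →ₗ[ℂ] H)).topologicalClosure
  have hAK : ∀ ξ, A ξ ∈ K := fun ξ =>
    Submodule.le_topologicalClosure _ (LinearMap.mem_range_self (A : H →ₗ[ℂ] H) ξ)
  let e : H →ₗ[ℂ] K := (A : H →ₗ[ℂ] H).codRestrict K hAK
  have hdense : DenseRange e := by
    intro y
    rw [Metric.mem_closure_iff]
    intro ε hε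
    have hy : (y : H) ∈ closure (Set.range A) := y.2
    obtain ⟨_, ⟨ξ, rfl⟩, hξ⟩ := Metric.mem_closure_iff.1 hy ε hε
    exact ⟨e ξ, ⟨ξ, rfl⟩, hξ⟩
  -- Since `|x| ξ` and `x ξ` have equal norms, `|x| ξ ↦ x ξ` is well defined and isometric on the
  -- range of `|x|`. It extends to the closure `K`, and is then set to zero on the orthogonal
  -- complement.
  have hnorm : ∀ ξ, ‖(x : H →ₗ[ℂ] H) ξ‖ ≤ 1 * ‖e ξ‖ := fun ξ => by
    rw [one_mul]
    exact (norm_cfcAbs_apply x ξ).ge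
  have : CompleteSpace K := (Submodule.isClosed_topologicalClosure _).completeSpace_coe
  let W : K →L[ℂ] H := (x : H →ₗ[ℂ] H).extendOfNorm e
  have hW : ∀ ξ, W (e ξ) = x ξ := LinearMap.extendOfNorm_eq hdense ⟨1, hnorm⟩
  have hWn : ‖W‖ ≤ 1 := LinearMap.opNorm_extendOfNorm_le hdense zero_le_one hnorm
  let v : H →L[ℂ] H := W ∘L K.orthogonalProjectionOnto
  have hv : ∀ ξ, v (A ξ) = x ξ := fun ξ => by
    rw [← hW]
    change W (K.orthogonalProjectionOnto (A ξ)) = _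
    congr 1
    exact Submodule.orthogonalProjectionOnto_mem_subspace_eq_self (K := K) (e ξ)
  have hvn : ‖v‖ ≤ 1 := (W.opNorm_comp_le _).trans
    (mul_le_one₀ hWn (norm_nonneg _) (Submodule.orthogonalProjectionOnto_norm_le K))
  refine ⟨v, hvn, ContinuousLinearMap.ext hv, ContinuousLinearMap.ext fun ξ => ?_⟩
  have hvs : ‖star v‖ ≤ 1 := by rwa [norm_star]
  have h1 : ‖(star v) (x ξ)‖ ≤ ‖A ξ‖ :=
    ((star v).le_of_opNorm_le hvs _).trans (by rw [one_mul, norm_cfcAbs_apply])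
  have h2 : inner ℂ ((star v) (x ξ)) (A ξ) = (‖A ξ‖ : ℂ) ^ 2 := by
    rw [ContinuousLinearMap.star_eq_adjoint, ContinuousLinearMap.adjoint_inner_left, hv,
      inner_self_eq_norm_sq_to_K, norm_cfcAbs_apply]
    rfl
  -- Equality case of Cauchy–Schwarz: `v* x ξ` is no longer than `|x| ξ` and its inner product with
  -- `|x| ξ` is `‖|x| ξ‖²`, so the two vectors coincide.
  have h3 := @norm_sub_sq ℂ _ _ _ _ ((star v) (x ξ)) (A ξ)
  rw [h2] at h3
  have h4 : RCLike.re ((‖A ξ‖ : ℂ) ^ 2) = ‖A ξ‖ ^ 2 := by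
    rw [← Complex.ofReal_pow]; rfl
  rw [h4] at h3
  have h5 : ‖(star v) (x ξ)‖ ^ 2 ≤ ‖A ξ‖ ^ 2 := by gcongr
  have h6 : ‖(star v) (x ξ) - A ξ‖ ^ 2 ≤ 0 := by linarith
  have h7 : ‖(star v) (x ξ) - A ξ‖ = 0 := by
    have := sq_nonneg ‖(star v) (x ξ) - A ξ‖
    exact pow_eq_zero_iff two_ne_zero |>.1 (le_antisymm h6 this)
  exact sub_eq_zero.1 (norm_eq_zero.1 h7)

/-- From `x = v |x|` and `v* x = |x|` one gets `x* = |x| v* = v* x v*`. Hence every symmetrically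
normed ideal is closed under adjoints, with a bounded involution, although neither is assumed. -/
theorem exists_star_eq_mul_mul (x : H →L[ℂ] H) :
    ∃ v : H →L[ℂ] H, ‖v‖ ≤ 1 ∧ star x = v * x * v := by
  obtain ⟨v, hv, h1, h2⟩ := exists_polarDecomposition x
  refine ⟨star v, by rwa [norm_star], ?_⟩
  have hsa : star (CFC.abs x) = CFC.abs x := (IsSelfAdjoint.of_nonneg (CFC.abs_nonneg x)).star_eq
  rw [h2]
  conv_lhs => rw [← h1]
  rw [star_mul, hsa]

end Polar

/-! ### The Banach space of a symmetrically normed ideal -/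

namespace SymmNormedIdeal

section Ideal

variable {H : Type*} [NormedAddCommGroup H] [InnerProductSpace ℂ H] (J : SymmNormedIdeal H)

theorem toOp_injective : Function.Injective J.toOp := Subtype.val_injective

theorem toOp_mem (x : J.Elem) : J.toOp x ∈ J.carrier :=
  Subtype.property (p := (· ∈ J.carrier)) x

/-- An operator in the ideal as an element of the Banach space `J`. -/
def ofMem (x : H →L[ℂ] H) (hx : x ∈ J.carrier) : J.Elem := ⟨x, hx⟩

@[simp] theorem toOp_ofMem (x : H →L[ℂ] H) (hx : x ∈ J.carrier) : J.toOp (J.ofMem x hx) = x := rfl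

theorem norm_mul_mul_le (a b : H →L[ℂ] H) (x z : J.Elem) (h : J.toOp z = a * J.toOp x * b) :
    ‖z‖ ≤ ‖a‖ * ‖x‖ * ‖b‖ := by
  obtain rfl : z = J.ofMem (a * J.toOp x * b) (J.mul_mem a b (J.toOp_mem x)) := J.toOp_injective h
  exact J.idealNorm_mul_le a b x

/-- For a unit vector `ξ` and `y = x ξ`, multiplying `x` by rank-one operators on both sides gives
`‖y‖²` times the projection onto `ξ`. The normalization on rank-one projections yields `‖y‖² ≤ ‖y‖
‖x‖_J`. -/
theorem norm_toOp_le (x : J.Elem) : ‖J.toOp x‖ ≤ ‖x‖ := by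
  refine ContinuousLinearMap.opNorm_le_of_unit_norm (norm_nonneg x) fun ξ hξ => ?_
  set y := J.toOp x ξ with hy
  rcases eq_or_ne y 0 with h0 | h0
  · simp [h0]
  have hop : InnerProductSpace.rankOne ℂ ξ y * J.toOp x * InnerProductSpace.rankOne ℂ ξ ξ
      = ((‖y‖ : ℂ) ^ 2) • InnerProductSpace.rankOne ℂ ξ ξ := by
    ext ζ
    simp [← hy, inner_self_eq_norm_sq_to_K, smul_smul, mul_comm]
  have hn : ((‖y‖ : ℂ) ^ 2) ≠ 0 := by simpa using h0
  have hmem : InnerProductSpace.rankOne ℂ ξ ξ ∈ J.carrier := by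
    have h := J.mul_mem (InnerProductSpace.rankOne ℂ ξ y) (InnerProductSpace.rankOne ℂ ξ ξ)
      (J.toOp_mem x)
    rw [hop] at h
    exact (Submodule.smul_mem_iff _ hn).1 h
  have h1 := J.norm_mul_mul_le _ _ x (((‖y‖ : ℂ) ^ 2) • J.ofMem _ hmem) hop.symm
  have h2 : ‖J.ofMem _ hmem‖ = 1 := J.idealNorm_rankOne ξ hmem hξ
  rw [norm_smul, h2, InnerProductSpace.norm_rankOne, InnerProductSpace.norm_rankOne, hξ] at h1
  simp only [norm_pow, Complex.norm_real, norm_norm, one_mul, mul_one] at h1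
  rw [sq] at h1
  exact le_of_mul_le_mul_left h1 (norm_pos_iff.2 h0)

theorem toOp_smul_real (t : ℝ) (x : J.Elem) : J.toOp (t • x) = t • J.toOp x :=
  J.toOp.map_smul (t : ℂ) x

/-- The inclusion of `J` into the bounded operators. -/
def toOpL : J.Elem →L[ℝ] (H →L[ℂ] H) :=
  LinearMap.mkContinuous
    { toFun := J.toOp
      map_add' := map_add _
      map_smul' := J.toOp_smul_real } 1 fun x => by simpa using J.norm_toOp_le x

@[simp] theorem toOpL_apply (x : J.Elem) : J.toOpL x = J.toOp x := rfl

/-- Left multiplication of elements of `J` by bounded operators. -/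
def mulL : (H →L[ℂ] H) →L[ℝ] J.Elem →L[ℝ] J.Elem :=
  LinearMap.mkContinuous₂
    (LinearMap.mk₂ ℝ (fun b x => J.ofMem (b * J.toOp x) (by
        simpa using J.mul_mem b 1 (J.toOp_mem x)))
      (fun b c x => J.toOp_injective (by simp [add_mul]))
      (fun t b x => J.toOp_injective (by simp))
      (fun b x y => J.toOp_injective (by simp [mul_add]))
      (fun t b x => J.toOp_injective (by simp))) 1 fun b x => by
    have := J.norm_mul_mul_le b (ContinuousLinearMap.id ℂ H) x
      (J.ofMem (b * J.toOp x) (by simpa using J.mul_mem b 1 (J.toOp_mem x))) rfl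
    refine this.trans ?_
    rw [one_mul]
    exact mul_le_of_le_one_right (by positivity) ContinuousLinearMap.norm_id_le

@[simp] theorem toOp_mulL (b : H →L[ℂ] H) (x : J.Elem) : J.toOp (J.mulL b x) = b * J.toOp x := rfl

/-- Right multiplication of elements of `J` by bounded operators. -/
def mulR : (H →L[ℂ] H) →L[ℝ] J.Elem →L[ℝ] J.Elem :=
  LinearMap.mkContinuous₂
    (LinearMap.mk₂ ℝ (fun b x => J.ofMem (J.toOp x * b) (by
        simpa using J.mul_mem 1 b (J.toOp_mem x)))
      (fun b c x => J.toOp_injective (by simp [mul_add]))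
      (fun t b x => J.toOp_injective (by simp))
      (fun b x y => J.toOp_injective (by simp [add_mul]))
      (fun t b x => J.toOp_injective (by simp))) 1 fun b x => by
    have := J.norm_mul_mul_le (ContinuousLinearMap.id ℂ H) b x
      (J.ofMem (J.toOp x * b) (by simpa using J.mul_mem 1 b (J.toOp_mem x))) rfl
    refine this.trans ?_
    rw [one_mul, mul_comm]
    gcongr
    exact mul_le_of_le_one_left (by positivity) ContinuousLinearMap.norm_id_le

@[simp] theorem toOp_mulR (b : H →L[ℂ] H) (x : J.Elem) : J.toOp (J.mulR b x) = J.toOp x * b := rfl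

variable [CompleteSpace H]

theorem star_mem {x : H →L[ℂ] H} (hx : x ∈ J.carrier) : star x ∈ J.carrier := by
  obtain ⟨v, -, h⟩ := exists_star_eq_mul_mul x
  rw [h]
  exact J.mul_mem v v hx

/-- The involution of `J`. -/
def starL : J.Elem →L[ℝ] J.Elem :=
  LinearMap.mkContinuous
    { toFun := fun x => J.ofMem (star (J.toOp x)) (J.star_mem (J.toOp_mem x))
      map_add' := fun x y => J.toOp_injective (by simp)
      map_smul' := fun t x => J.toOp_injective (by simp) } 1 fun x => by
    obtain ⟨v, hv, h⟩ := exists_star_eq_mul_mul (J.toOp x)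
    refine (J.norm_mul_mul_le v v x _ h).trans ?_
    rw [one_mul]
    calc ‖v‖ * ‖x‖ * ‖v‖ ≤ 1 * ‖x‖ * 1 := by gcongr
      _ = ‖x‖ := by ring

@[simp] theorem toOp_starL (x : J.Elem) : J.toOp (J.starL x) = star (J.toOp x) := rfl

theorem mem_lieAlg_iff (x : J.Elem) : x ∈ J.lieAlg ↔ star (J.toOp x) = -J.toOp x := Iff.rfl

/-- The projection `x ↦ (x - x*) / 2` of `J` onto `𝔲_J`. -/
def skewPart : J.Elem →L[ℝ] J.lieAlg :=
  ((2⁻¹ : ℝ) • (ContinuousLinearMap.id ℝ J.Elem - J.starL)).codRestrict J.lieAlg fun x => by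
    rw [mem_lieAlg_iff]
    simp [← smul_neg]

theorem skewPart_coe (x : J.lieAlg) : J.skewPart (x : J.Elem) = x := by
  have hx : star (J.toOp x) = -J.toOp x := x.2
  refine Subtype.ext (J.toOp_injective ?_)
  change J.toOp ((2⁻¹ : ℝ) • ((x : J.Elem) - J.starL x)) = _
  rw [toOp_smul_real, map_sub, toOp_starL, hx, sub_neg_eq_add, ← two_smul ℝ, smul_smul]
  norm_num

theorem isClosed_lieAlg : IsClosed (J.lieAlg : Set J.Elem) := by
  have : (J.lieAlg : Set J.Elem) = {x | J.starL x = -x} := by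
    ext x
    exact ⟨fun h => J.toOp_injective ((J.mem_lieAlg_iff x).1 h), fun h =>
      (J.mem_lieAlg_iff x).2 (congrArg J.toOp h)⟩
  rw [this]
  exact isClosed_eq J.starL.continuous continuous_neg

instance : CompleteSpace J.lieAlg := J.isClosed_lieAlg.completeSpace_coe

theorem isClosed_isotropyLieAlg (a : H →L[ℂ] H) :
    IsClosed (J.isotropyLieAlg a : Set J.lieAlg) := by
  have : (J.isotropyLieAlg a : Set J.lieAlg)
      = {x : J.lieAlg | J.toOpL (x : J.Elem) * a = a * J.toOpL (x : J.Elem)} := by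
    ext x
    exact J.mem_lieSet_isotropy_iff a x
  rw [this]
  refine isClosed_eq ?_ ?_ <;> fun_prop

instance (a : H →L[ℂ] H) : CompleteSpace (J.isotropyLieAlg a) :=
  (J.isClosed_isotropyLieAlg a).completeSpace_coe

end Ideal

end SymmNormedIdeal

/-! ### The flow generated by a normal operator -/

section Flow

variable {H : Type*} [NormedAddCommGroup H] [InnerProductSpace ℂ H] [CompleteSpace H]

/-- The skew-adjoint generator `i (s Re a + t Im a)`. -/
def flowGen (a : H →L[ℂ] H) (p : ℝ × ℝ) : H →L[ℂ] H :=
  Complex.I • (p.1 • (ℜ a : H →L[ℂ] H) + p.2 • (ℑ a : H →L[ℂ] H))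

/-- The unitary `exp (i (s Re a + t Im a))`. -/
def flowUnitary (a : H →L[ℂ] H) (p : ℝ × ℝ) : H →L[ℂ] H := NormedSpace.exp (flowGen a p)

theorem star_flowGen (a : H →L[ℂ] H) (p : ℝ × ℝ) : star (flowGen a p) = -flowGen a p := by
  have h1 : star (ℜ a : H →L[ℂ] H) = ℜ a := (ℜ a).2
  have h2 : star (ℑ a : H →L[ℂ] H) = ℑ a := (ℑ a).2
  simp [flowGen, h1, h2, add_comm]

theorem flowGen_add (a : H →L[ℂ] H) (p q : ℝ × ℝ) :
    flowGen a (p + q) = flowGen a p + flowGen a q := by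
  simp only [flowGen, Prod.fst_add, Prod.snd_add, add_smul, smul_add]
  abel

theorem star_flowUnitary (a : H →L[ℂ] H) (p : ℝ × ℝ) :
    star (flowUnitary a p) = NormedSpace.exp (-flowGen a p) := by
  rw [flowUnitary, NormedSpace.star_exp, star_flowGen]

theorem flowUnitary_mul_star (a : H →L[ℂ] H) (p : ℝ × ℝ) :
    flowUnitary a p * star (flowUnitary a p) = 1 := by
  let _ : NormedAlgebra ℚ (H →L[ℂ] H) := NormedAlgebra.restrictScalars ℚ ℝ (H →L[ℂ] H)
  rw [star_flowUnitary, flowUnitary,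
    ← NormedSpace.exp_add_of_commute (Commute.neg_right (Commute.refl _))]
  simp

theorem star_mul_flowUnitary (a : H →L[ℂ] H) (p : ℝ × ℝ) :
    star (flowUnitary a p) * flowUnitary a p = 1 := by
  let _ : NormedAlgebra ℚ (H →L[ℂ] H) := NormedAlgebra.restrictScalars ℚ ℝ (H →L[ℂ] H)
  rw [star_flowUnitary, flowUnitary,
    ← NormedSpace.exp_add_of_commute (Commute.neg_left (Commute.refl _))]
  simp

theorem norm_flowUnitary_le (a : H →L[ℂ] H) (p : ℝ × ℝ) : ‖flowUnitary a p‖ ≤ 1 := by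
  have h : ‖flowUnitary a p‖ * ‖flowUnitary a p‖ ≤ 1 := by
    rw [← CStarRing.norm_star_mul_self, star_mul_flowUnitary]
    exact ContinuousLinearMap.norm_id_le
  nlinarith [norm_nonneg (flowUnitary a p)]

theorem conjFlow_eq (a : H →L[ℂ] H) (p : ℝ × ℝ) (x : H →L[ℂ] H) :
    conjFlow a p x = flowUnitary a p * x * star (flowUnitary a p) := by
  rw [star_flowUnitary]; rfl

/-- The single point where normality enters: it makes `p ↦ flowUnitary a p` a homomorphism on `ℝ²`.
-/
theorem commute_realPart_imaginaryPart {a : H →L[ℂ] H} (ha : IsStarNormal a) :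
    Commute (ℜ a : H →L[ℂ] H) (ℑ a : H →L[ℂ] H) := by
  have h : Commute a (star a) := ha.star_comm_self.symm
  rw [realPart_apply_coe, imaginaryPart_apply_coe]
  refine Commute.smul_left (Commute.smul_right (Commute.smul_right ?_ _) _) _
  exact (((Commute.refl a).sub_right h).add_left (h.symm.sub_right (Commute.refl _)))

theorem flowUnitary_add {a : H →L[ℂ] H} (ha : IsStarNormal a) (p q : ℝ × ℝ) :
    flowUnitary a (p + q) = flowUnitary a p * flowUnitary a q := by
  let _ : NormedAlgebra ℚ (H →L[ℂ] H) := NormedAlgebra.restrictScalars ℚ ℝ (H →L[ℂ] H)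
  have hc := commute_realPart_imaginaryPart ha
  rw [flowUnitary, flowGen_add, NormedSpace.exp_add_of_commute]
  · rfl
  refine Commute.smul_left (Commute.smul_right ?_ _) _
  refine Commute.add_left (Commute.add_right ?_ ?_) (Commute.add_right ?_ ?_)
  · exact ((Commute.refl _).smul_left _).smul_right _
  · exact (hc.smul_left _).smul_right _
  · exact (hc.symm.smul_left _).smul_right _
  · exact ((Commute.refl _).smul_left _).smul_right _

theorem conjFlow_of_commute {a x : H →L[ℂ] H} (h : Commute x a) (h' : Commute x (star a))
    (p : ℝ × ℝ) : conjFlow a p x = x := by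
  have h1 : Commute x (ℜ a : H →L[ℂ] H) := by
    rw [realPart_apply_coe]; exact (h.add_right h').smul_right _
  have h2 : Commute x (ℑ a : H →L[ℂ] H) := by
    rw [imaginaryPart_apply_coe]; exact ((h.sub_right h').smul_right _).smul_right _
  have h3 : Commute x (flowGen a p) :=
    ((h1.smul_right _).add_right (h2.smul_right _)).smul_right _
  have h4 : Commute x (flowUnitary a p) := h3.exp_right
  rw [conjFlow_eq, ← h4.eq, mul_assoc, flowUnitary_mul_star, mul_one]

/-- Differentiating the commutation relation at `0` along each coordinate axis gives commutation
with `Re a` and with `Im a`. -/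
theorem commute_of_flowUnitary {a x : H →L[ℂ] H} (h : ∀ p, Commute (flowUnitary a p) x) :
    Commute x a := by
  have key : ∀ y : H →L[ℂ] H, (∀ t : ℝ, Commute (NormedSpace.exp (t • Complex.I • y)) x) →
      Commute y x := by
    intro y hy
    have hd := hasDerivAt_exp_smul_const (𝕂 := ℝ) (Complex.I • y) (0 : ℝ)
    have hl := hd.mul_const x
    have hr := hd.const_mul x
    rw [funext fun t => (hy t).eq] at hl
    have h1 := hl.unique hr
    simp only [zero_smul, NormedSpace.exp_zero, one_mul, smul_mul_assoc, mul_smul_comm] at h1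
    exact smul_right_injective _ Complex.I_ne_zero h1
  have h1 : Commute (ℜ a : H →L[ℂ] H) x := key _ fun t => by
    have := h (t, 0)
    rwa [flowUnitary, flowGen, zero_smul, add_zero, smul_comm] at this
  have h2 : Commute (ℑ a : H →L[ℂ] H) x := key _ fun t => by
    have := h (0, t)
    rwa [flowUnitary, flowGen, zero_smul, zero_add, smul_comm] at this
  rw [← realPart_add_I_smul_imaginaryPart a]
  exact h1.symm.add_right (h2.symm.smul_right _)

end Flow

/-! ### The conditional expectation onto the commutant -/

section Expectation

variable {H : Type*} [NormedAddCommGroup H] [InnerProductSpace ℂ H] [CompleteSpace H]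

/-- Parseval's identity. Pairing with rank-one operators of `J₁` thereby recovers the matrix
coefficients of an element of `J`. -/
theorem opTrace_mul_rankOne (x : H →L[ℂ] H) (ξ η : H) :
    opTrace (x * InnerProductSpace.rankOne ℂ ξ η) = inner ℂ η (x ξ) := by
  rw [opTrace, ← (traceBasis H).tsum_inner_mul_inner η (x ξ)]
  refine tsum_congr fun i => ?_
  simp

namespace SymmNormedIdeal

omit [CompleteSpace H] in
theorem rankOne_mem {J : SymmNormedIdeal H} {y : J.Elem} (hy : y ≠ 0) (ξ η : H) :
    InnerProductSpace.rankOne ℂ ξ η ∈ J.carrier := by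
  have hy' : J.toOp y ≠ 0 := fun h => hy (J.toOp_injective (by simpa using h))
  obtain ⟨ζ, hζ⟩ : ∃ ζ, J.toOp y ζ ≠ 0 := by
    by_contra! h
    exact hy' (ContinuousLinearMap.ext h)
  have h := J.mul_mem (InnerProductSpace.rankOne ℂ ξ (J.toOp y ζ))
    (InnerProductSpace.rankOne ℂ ζ η) (J.toOp_mem y)
  have hop : InnerProductSpace.rankOne ℂ ξ (J.toOp y ζ) * J.toOp y *
      InnerProductSpace.rankOne ℂ ζ η
      = (inner ℂ (J.toOp y ζ) (J.toOp y ζ)) • InnerProductSpace.rankOne ℂ ξ η := by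
    ext χ
    simp [smul_smul, mul_comm]
  rw [hop] at h
  exact (Submodule.smul_mem_iff _ (inner_self_ne_zero.2 hζ)).1 h

/-- The flow `conjFlow a` acting on the ideal `J`. -/
def conjFlowElem (J : SymmNormedIdeal H) (a : H →L[ℂ] H) (p : ℝ × ℝ) (x : J.Elem) : J.Elem :=
  J.ofMem (conjFlow a p (J.toOp x)) (J.mul_mem _ _ (J.toOp_mem x))

theorem norm_conjFlowElem_le (J : SymmNormedIdeal H) (a : H →L[ℂ] H) (p : ℝ × ℝ) (x : J.Elem) :
    ‖J.conjFlowElem a p x‖ ≤ ‖x‖ := by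
  have h1 := norm_flowUnitary_le a p
  have h2 : ‖star (flowUnitary a p)‖ ≤ 1 := by rwa [norm_star]
  calc ‖J.conjFlowElem a p x‖ ≤ ‖flowUnitary a p‖ * ‖x‖ * ‖star (flowUnitary a p)‖ :=
        J.norm_mul_mul_le _ _ x _ (conjFlow_eq a p _)
    _ ≤ 1 * ‖x‖ * 1 := by gcongr
    _ = ‖x‖ := by ring

theorem norm_dual_conjFlowElem_le {J J₁ : SymmNormedIdeal H}
    (D : J.Elem ≃ₗᵢ[ℂ] StrongDual ℂ J₁.Elem) (a : H →L[ℂ] H) (x : J.Elem) (y : J₁.Elem)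
    (p : ℝ × ℝ) : ‖D (J.conjFlowElem a p x) y‖ ≤ ‖x‖ * ‖y‖ := by
  refine (ContinuousLinearMap.le_opNorm _ _).trans ?_
  rw [D.norm_map]
  gcongr
  exact J.norm_conjFlowElem_le a p x

/-- The matrix coefficient `p ↦ Tr (conjFlow a p x · y)` as a bounded function. -/
def flowCoeff {J J₁ : SymmNormedIdeal H} (D : J.Elem ≃ₗᵢ[ℂ] StrongDual ℂ J₁.Elem)
    (a : H →L[ℂ] H) (x : J.Elem) (y : J₁.Elem) : lp (fun _ : ℝ × ℝ => ℂ) ∞ :=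
  lpInftyMk (fun p => D (J.conjFlowElem a p x) y) (‖x‖ * ‖y‖) (norm_dual_conjFlowElem_le D a x y)

/-- The functional `y ↦ μ (p ↦ Tr (conjFlow a p x · y))`, depending linearly on `x`. -/
def averageDual {J J₁ : SymmNormedIdeal H} (D : J.Elem ≃ₗᵢ[ℂ] StrongDual ℂ J₁.Elem)
    (a : H →L[ℂ] H) (μ : lp (fun _ : ℝ × ℝ => ℂ) ∞ →L[ℂ] ℂ) :
    J.Elem →L[ℂ] J₁.Elem →L[ℂ] ℂ :=
  LinearMap.mkContinuous₂
    (LinearMap.mk₂ ℂ (fun x y => μ (flowCoeff D a x y))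
      (fun x x' y => by
        rw [← map_add]
        congr 1
        refine lp.ext (funext fun p => ?_)
        have : J.conjFlowElem a p (x + x') = J.conjFlowElem a p x + J.conjFlowElem a p x' :=
          J.toOp_injective (by simp [conjFlowElem, conjFlow_eq, mul_add, add_mul])
        change D (J.conjFlowElem a p (x + x')) y
          = D (J.conjFlowElem a p x) y + D (J.conjFlowElem a p x') y
        simp [this])
      (fun c x y => by
        rw [← map_smul]
        congr 1
        refine lp.ext (funext fun p => ?_)
        have : J.conjFlowElem a p (c • x) = c • J.conjFlowElem a p x :=
          J.toOp_injective (by simp [conjFlowElem, conjFlow_eq])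
        change D (J.conjFlowElem a p (c • x)) y = c • D (J.conjFlowElem a p x) y
        simp [this])
      (fun x y y' => by
        rw [← map_add]
        congr 1
        exact lp.ext (funext fun p => map_add (D (J.conjFlowElem a p x)) y y'))
      (fun c x y => by
        rw [← map_smul]
        congr 1
        exact lp.ext (funext fun p => map_smul (D (J.conjFlowElem a p x)) c y)))
    ‖μ‖ fun x y => by
      rw [mul_assoc]
      refine (μ.le_opNorm _).trans ?_
      gcongr
      exact norm_lpInftyMk_le _ _ (by positivity)

theorem averageDual_apply {J J₁ : SymmNormedIdeal H} (D : J.Elem ≃ₗᵢ[ℂ] StrongDual ℂ J₁.Elem)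
    (a : H →L[ℂ] H) (μ : lp (fun _ : ℝ × ℝ => ℂ) ∞ →L[ℂ] ℂ) (x : J.Elem) (y : J₁.Elem) :
    averageDual D a μ x y = μ (flowCoeff D a x y) := rfl

/-- The average of the flow of `a` on `J`, with respect to the mean `μ`. -/
def flowAverage {J J₁ : SymmNormedIdeal H} (D : J.Elem ≃ₗᵢ[ℂ] StrongDual ℂ J₁.Elem)
    (a : H →L[ℂ] H) (μ : lp (fun _ : ℝ × ℝ => ℂ) ∞ →L[ℂ] ℂ) : J.Elem →L[ℂ] J.Elem :=
  (D.symm.toContinuousLinearEquiv : StrongDual ℂ J₁.Elem →L[ℂ] J.Elem) ∘L averageDual D a μ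

theorem dual_flowAverage {J J₁ : SymmNormedIdeal H} (D : J.Elem ≃ₗᵢ[ℂ] StrongDual ℂ J₁.Elem)
    (a : H →L[ℂ] H) (μ : lp (fun _ : ℝ × ℝ => ℂ) ∞ →L[ℂ] ℂ) (x : J.Elem) (y : J₁.Elem) :
    D (flowAverage D a μ x) y = μ (flowCoeff D a x y) := by
  rw [← averageDual_apply]
  change D (D.symm (averageDual D a μ x)) y = _
  rw [D.apply_symm_apply]

variable {J J₁ : SymmNormedIdeal H} {D : J.Elem ≃ₗᵢ[ℂ] StrongDual ℂ J₁.Elem}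
  {a : H →L[ℂ] H} {μ : lp (fun _ : ℝ × ℝ => ℂ) ∞ →L[ℂ] ℂ}

/-- The matrix coefficients of the average are the averages of the matrix coefficients. -/
theorem exists_inner_flowAverage
    (hD : ∀ (x : J.Elem) (y : J₁.Elem), D x y = opTrace (J.toOp x * J₁.toOp y))
    (x : J.Elem) (ξ η : H) :
    ∃ f : lp (fun _ : ℝ × ℝ => ℂ) ∞, (∀ p, f p = inner ℂ η (conjFlow a p (J.toOp x) ξ)) ∧
      inner ℂ η (J.toOp (flowAverage D a μ x) ξ) = μ f := by
  by_cases h : ∃ y : J₁.Elem, y ≠ 0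
  · obtain ⟨y, hy⟩ := h
    let r := J₁.ofMem _ (rankOne_mem hy ξ η)
    have hr : ∀ z : J.Elem, D z r = inner ℂ η (J.toOp z ξ) := fun z => by
      rw [hD, toOp_ofMem, opTrace_mul_rankOne]
    refine ⟨flowCoeff D a x r, fun p => hr _, ?_⟩
    rw [← hr, dual_flowAverage]
  -- If `J₁` is zero, so is its dual, and therefore `J`; there are then no rank-one operators to
  -- test against, and none are needed.
  · push Not at h
    have hz : ∀ z : J.Elem, z = 0 := fun z => D.injective (by
      ext y
      simp [h y])
    refine ⟨0, fun p => ?_, ?_⟩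
    · rw [hz x]
      simp [conjFlow_eq]
    · rw [hz (flowAverage D a μ x)]
      simp

theorem star_flowAverage
    (hD : ∀ (x : J.Elem) (y : J₁.Elem), D x y = opTrace (J.toOp x * J₁.toOp y))
    (hμ : IsInvariantMean μ) {x : J.Elem} (hx : star (J.toOp x) = -J.toOp x) :
    star (J.toOp (flowAverage D a μ x)) = -J.toOp (flowAverage D a μ x) := by
  refine ContinuousLinearMap.ext fun ξ => ext_inner_left ℂ fun η => ?_
  obtain ⟨f, hf, hf'⟩ := exists_inner_flowAverage (a := a) (μ := μ) hD x ξ η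
  obtain ⟨g, hg, hg'⟩ := exists_inner_flowAverage (a := a) (μ := μ) hD x η ξ
  rw [ContinuousLinearMap.star_eq_adjoint, ContinuousLinearMap.adjoint_inner_right,
    ← inner_conj_symm, hg', neg_apply, inner_neg_right, hf', ← map_neg]
  refine (hμ.map_conj g (-f) fun p => ?_).symm
  change -(f p) = _
  have hs : star (conjFlow a p (J.toOp x)) = -conjFlow a p (J.toOp x) := by
    simp [conjFlow_eq, hx, mul_assoc]
  rw [hf, hg, inner_conj_symm, ← ContinuousLinearMap.adjoint_inner_right,
    ← ContinuousLinearMap.star_eq_adjoint, hs]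
  simp

/-- Evaluating at the rotated vectors `U_q ξ`, `U_q η` translates the coefficient function by `-q`,
which the mean does not see. So the average is invariant under conjugation by every `U_q`. -/
theorem commute_flowAverage
    (hD : ∀ (x : J.Elem) (y : J₁.Elem), D x y = opTrace (J.toOp x * J₁.toOp y))
    (hμ : IsInvariantMean μ) (ha : IsStarNormal a) (x : J.Elem) :
    Commute (J.toOp (flowAverage D a μ x)) a := by
  refine commute_of_flowUnitary fun q => ?_
  have key : star (flowUnitary a q) * J.toOp (flowAverage D a μ x) * flowUnitary a q
      = J.toOp (flowAverage D a μ x) := by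
    refine ContinuousLinearMap.ext fun ξ => ext_inner_left ℂ fun η => ?_
    obtain ⟨f, hf, hf'⟩ := exists_inner_flowAverage (a := a) (μ := μ) hD x ξ η
    obtain ⟨g, hg, hg'⟩ := exists_inner_flowAverage (a := a) (μ := μ) hD x
      (flowUnitary a q ξ) (flowUnitary a q η)
    have hadj : ∀ T : H →L[ℂ] H, inner ℂ (flowUnitary a q η) (T (flowUnitary a q ξ))
        = inner ℂ η ((star (flowUnitary a q) * T * flowUnitary a q) ξ) := fun T => by
      rw [mul_apply_eq_comp, mul_apply_eq_comp, ContinuousLinearMap.star_eq_adjoint,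
        ContinuousLinearMap.adjoint_inner_right]
    rw [← hadj, hf', hg']
    refine (hμ.translate (-q) f g fun p => ?_)
    rw [hf, hg, hadj, conjFlow_eq, conjFlow_eq, flowUnitary_add ha, star_mul]
    have h1 : flowUnitary a (-q) = star (flowUnitary a q) := by
      have h2 : flowUnitary a q * flowUnitary a (-q) = 1 := by
        rw [← flowUnitary_add ha, add_neg_cancel]
        simp [flowUnitary, flowGen]
      calc flowUnitary a (-q)
          = star (flowUnitary a q) * flowUnitary a q * flowUnitary a (-q) := by
            rw [star_mul_flowUnitary, one_mul]
        _ = star (flowUnitary a q) := by rw [mul_assoc, h2, mul_one]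
    rw [h1, star_star]
    congr 2
  calc flowUnitary a q * J.toOp (flowAverage D a μ x)
      = flowUnitary a q * (star (flowUnitary a q) * J.toOp (flowAverage D a μ x) *
          flowUnitary a q) := by rw [key]
    _ = flowUnitary a q * star (flowUnitary a q) * J.toOp (flowAverage D a μ x) *
          flowUnitary a q := by noncomm_ring
    _ = _ := by rw [flowUnitary_mul_star, one_mul]

/-- All coefficient functions are constant on a fixed point of the flow, and `μ` is normalized. -/
theorem flowAverage_of_commute
    (hμ : IsInvariantMean μ) {x : J.Elem} (h : Commute (J.toOp x) a)
    (h' : Commute (J.toOp x) (star a)) : flowAverage D a μ x = x := by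
  apply D.injective
  ext y
  rw [dual_flowAverage]
  let e := lpInftyMk (fun _ : ℝ × ℝ => (1 : ℂ)) 1 (by simp)
  have he : μ e = 1 := hμ.one e fun _ => rfl
  have hf : flowCoeff D a x y = D x y • e := by
    refine lp.ext (funext fun p => ?_)
    have hx : J.conjFlowElem a p x = x := J.toOp_injective (conjFlow_of_commute h h' p)
    change D (J.conjFlowElem a p x) y = D x y • (1 : ℂ)
    rw [hx, smul_eq_mul, mul_one]
  rw [hf, map_smul, he, smul_eq_mul, mul_one]

theorem exists_expectation (hJ : J.IsDualPair J₁) (ha : IsStarNormal a) :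
    ∃ E : J.lieAlg →L[ℝ] J.lieAlg,
      (∀ x, E x ∈ J.isotropyLieAlg a) ∧ (∀ x ∈ J.isotropyLieAlg a, E x = x) ∧
      ∃ μ : lp (fun _ : ℝ × ℝ => ℂ) ∞ →L[ℂ] ℂ, IsInvariantMean μ ∧ IsAverage J J₁ a μ E := by
  obtain ⟨-, D, hD⟩ := hJ
  obtain ⟨μ, hμ⟩ := exists_isInvariantMean (ℝ × ℝ)
  let E : J.lieAlg →L[ℝ] J.lieAlg :=
    (((flowAverage D a μ).restrictScalars ℝ) ∘L J.lieAlg.subtypeL).codRestrict J.lieAlg fun x =>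
      star_flowAverage hD hμ x.2
  have hE : ∀ x, ((E x : J.lieAlg) : J.Elem) = flowAverage D a μ (x : J.Elem) := fun _ => rfl
  refine ⟨E, fun x => ?_, fun x hx => ?_, μ, hμ, fun x y => ?_⟩
  · exact (J.mem_lieSet_isotropy_iff a (E x)).2 (commute_flowAverage hD hμ ha _)
  · have h1 : Commute (J.toOp x) a := (J.mem_lieSet_isotropy_iff a x).1 hx
    have h2 : star (J.toOp x) = -J.toOp x := x.2
    refine Subtype.ext (flowAverage_of_commute hμ h1 ?_)
    -- For skew-adjoint `x`, commuting with `a` gives commuting with `a*` by taking adjoints;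
    -- Fuglede's theorem is not needed.
    have h3 := h1.star_star
    rw [h2] at h3
    simpa using h3.neg_left
  · refine ⟨flowCoeff D a x y, fun p => hD _ _, ?_⟩
    rw [← hD, hE, dual_flowAverage]

end SymmNormedIdeal

end Expectation

/-! ### Submanifolds of a Banach space given by slice charts -/

section Slice

open Set Topology

/-- A topological space `M` embedded in a Banach space `V`, with local analytic coordinates of `V`
that straighten `M` to a complemented subspace `S`. -/
structure SliceData (V S M : Type*) [NormedAddCommGroup V] [NormedSpace ℝ V]
    [NormedAddCommGroup S] [NormedSpace ℝ S] [TopologicalSpace M] where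
  ι : M → V
  isEmbedding : IsEmbedding ι
  j : S →L[ℝ] V
  p : V →L[ℝ] S
  p_j : ∀ s, p (j s) = s
  Φ : M → OpenPartialHomeomorph V V
  mem_source : ∀ m, ι m ∈ (Φ m).source
  contDiffOn : ∀ m, ContDiffOn ℝ ω (Φ m) (Φ m).source
  contDiffOn_symm : ∀ m, ContDiffOn ℝ ω (Φ m).symm (Φ m).target
  slice : ∀ m, ∀ v ∈ (Φ m).source, v ∈ range ι ↔ Φ m v ∈ range j

namespace SliceData

variable {V S M : Type*} [NormedAddCommGroup V] [NormedSpace ℝ V]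
  [NormedAddCommGroup S] [NormedSpace ℝ S] [TopologicalSpace M] (D : SliceData V S M)

/-- The point of `M` with slice coordinate `s`. -/
def point (m : M) (s : S) : M :=
  open Classical in if h : (D.Φ m).symm (D.j s) ∈ range D.ι then h.choose else m

theorem ι_point {m : M} {s : S} (hs : D.j s ∈ (D.Φ m).target) :
    D.ι (D.point m s) = (D.Φ m).symm (D.j s) := by
  have h : (D.Φ m).symm (D.j s) ∈ range D.ι := by
    rw [D.slice m _ ((D.Φ m).map_target hs), (D.Φ m).right_inv hs]
    exact mem_range_self s
  rw [point, dif_pos h]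
  exact h.choose_spec

theorem j_p {m m' : M} (hm : D.ι m' ∈ (D.Φ m).source) :
    D.j (D.p (D.Φ m (D.ι m'))) = D.Φ m (D.ι m') := by
  obtain ⟨s, hs⟩ := (D.slice m _ hm).1 (mem_range_self m')
  rw [← hs, D.p_j]

/-- The chart of `M` obtained by restricting ambient coordinates. -/
def chart (m : M) : OpenPartialHomeomorph M S where
  toFun m' := D.p (D.Φ m (D.ι m'))
  invFun := D.point m
  source := D.ι ⁻¹' (D.Φ m).source
  target := D.j ⁻¹' (D.Φ m).target
  map_source' m' hm := by
    rw [mem_preimage, D.j_p hm]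
    exact (D.Φ m).map_source hm
  map_target' s hs := by
    rw [mem_preimage, D.ι_point hs]
    exact (D.Φ m).map_target hs
  left_inv' m' hm := D.isEmbedding.injective (by
    rw [D.ι_point, D.j_p hm, (D.Φ m).left_inv hm]
    rw [D.j_p hm]
    exact (D.Φ m).map_source hm)
  right_inv' s hs := by
    rw [D.ι_point hs, (D.Φ m).right_inv hs, D.p_j]
  open_source := (D.Φ m).open_source.preimage D.isEmbedding.continuous
  open_target := (D.Φ m).open_target.preimage D.j.continuous
  continuousOn_toFun := D.p.continuous.comp_continuousOn
    ((D.Φ m).continuousOn.comp D.isEmbedding.continuous.continuousOn fun _ h => h)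
  continuousOn_invFun := by
    rw [D.isEmbedding.continuousOn_iff]
    exact ((D.Φ m).continuousOn_symm.comp D.j.continuous.continuousOn fun _ h => h).congr
      fun s hs => D.ι_point hs

theorem chart_apply (m m' : M) : D.chart m m' = D.p (D.Φ m (D.ι m')) := rfl

theorem mem_chart_source (m : M) : m ∈ (D.chart m).source := D.mem_source m

theorem ι_chart_symm {m : M} {s : S} (hs : s ∈ (D.chart m).target) :
    D.ι ((D.chart m).symm s) = (D.Φ m).symm (D.j s) := D.ι_point hs

/-- The atlas of slice charts. -/
@[reducible] def chartedSpace : ChartedSpace S M where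
  atlas := range D.chart
  chartAt := D.chart
  mem_chart_source := D.mem_chart_source
  chart_mem_atlas m := mem_range_self m

/-- The charted space structure of `M` is the one of the slice charts. -/
structure IsCompatible [ChartedSpace S M] : Prop where
  chartAt_eq : ∀ m, chartAt S m = D.chart m
  atlas_subset : atlas S M ⊆ range D.chart

variable {D} [ChartedSpace S M]

/-- Transition maps have the form `p ∘ Φ' ∘ Φ⁻¹ ∘ j`, with `p` and `j` bounded linear. -/
theorem IsCompatible.isManifold (hD : D.IsCompatible) : IsManifold 𝓘(ℝ, S) ω M := by
  refine isManifold_of_contDiffOn _ _ _ fun e e' he he' => ?_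
  obtain ⟨m, rfl⟩ := hD.atlas_subset he
  obtain ⟨m', rfl⟩ := hD.atlas_subset he'
  have hmaps : MapsTo (fun s => (D.Φ m).symm (D.j s))
      ((D.chart m).symm ≫ₕ D.chart m').source (D.Φ m').source := by
    intro s hs
    rw [OpenPartialHomeomorph.trans_source] at hs
    have h1 := D.ι_chart_symm hs.1
    have h2 : D.ι ((D.chart m).symm s) ∈ (D.Φ m').source := hs.2
    rwa [h1] at h2
  have h : ContDiffOn ℝ ω (fun s => D.p (D.Φ m' ((D.Φ m).symm (D.j s))))
      ((D.chart m).symm ≫ₕ D.chart m').source := by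
    refine D.p.contDiff.comp_contDiffOn ((D.contDiffOn m').comp ?_ hmaps)
    refine (D.contDiffOn_symm m).comp D.j.contDiff.contDiffOn fun s hs => ?_
    rw [OpenPartialHomeomorph.trans_source] at hs
    exact hs.1
  simp only [modelWithCornersSelf_coe, modelWithCornersSelf_coe_symm,
    preimage_id, range_id, inter_univ, CompTriple.comp_eq]
  refine h.congr fun s hs => ?_
  rw [OpenPartialHomeomorph.trans_source] at hs
  rw [OpenPartialHomeomorph.coe_trans, Function.comp_apply, chart_apply, D.ι_chart_symm hs.1]

theorem IsCompatible.chart_mem_maximalAtlas (hD : D.IsCompatible) (m : M) :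
    D.chart m ∈ IsManifold.maximalAtlas 𝓘(ℝ, S) ω M := by
  have := hD.isManifold
  rw [← hD.chartAt_eq]
  exact IsManifold.chart_mem_maximalAtlas m

/-- An open partial homeomorphism of a normed space, analytic in both directions, is a chart. -/
theorem _root_.OpenPartialHomeomorph.mem_maximalAtlas_of_contDiffOn
    (e : OpenPartialHomeomorph V V) (h : ContDiffOn ℝ ω e e.source)
    (h' : ContDiffOn ℝ ω e.symm e.target) : e ∈ IsManifold.maximalAtlas 𝓘(ℝ, V) ω V :=
  e.mem_maximalAtlas_of_contMDiffOn (contMDiffOn_iff_contDiffOn.2 h)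
    (contMDiffOn_iff_contDiffOn.2 h')

/-- A retraction of `V` onto `S` splits `V`. -/
def splitting (D : SliceData V S M) :
    (S × LinearMap.ker (D.p : V →ₗ[ℝ] S)) ≃L[ℝ] V :=
  ContinuousLinearEquiv.equivOfInverse
    (D.j.comp (ContinuousLinearMap.fst ℝ _ _) +
      (LinearMap.ker (D.p : V →ₗ[ℝ] S)).subtypeL.comp (ContinuousLinearMap.snd ℝ _ _))
    (D.p.prod ((ContinuousLinearMap.id ℝ V - D.j.comp D.p).codRestrict _ fun v => by
      simp [D.p_j]))
    (fun x => by
      have h : D.p (x.2 : V) = 0 := x.2.2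
      ext <;> simp [D.p_j, h])
    (fun v => by simp)

omit [ChartedSpace S M] in
theorem splitting_apply (D : SliceData V S M) (s : S) : D.splitting (s, 0) = D.j s := by
  simp [splitting]

/-- Read in a slice chart and its ambient chart, `ι` is the linear inclusion `j`, and `ker p` is a
closed complement of its range. -/
theorem IsCompatible.isSmoothEmbedding (hD : D.IsCompatible) :
    Manifold.IsSmoothEmbedding 𝓘(ℝ, S) 𝓘(ℝ, V) ω D.ι := by
  refine ⟨⟨LinearMap.ker (D.p : V →ₗ[ℝ] S), inferInstance, inferInstance, fun m => ?_⟩,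
    D.isEmbedding⟩
  refine Manifold.IsImmersionAtOfComplement.mk_of_charts D.splitting (D.chart m) (D.Φ m)
    (D.mem_chart_source m) (D.mem_source m) (hD.chart_mem_maximalAtlas m)
    ((D.Φ m).mem_maximalAtlas_of_contDiffOn (D.contDiffOn m) (D.contDiffOn_symm m))
    (fun _ h => h) fun s hs => ?_
  have hs' : s ∈ (D.chart m).target := by simpa using hs
  simp only [Function.comp_apply, OpenPartialHomeomorph.extend_coe,
    OpenPartialHomeomorph.extend_coe_symm, modelWithCornersSelf_coe,
    modelWithCornersSelf_coe_symm, id, D.splitting_apply]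
  rw [D.ι_chart_symm hs', (D.Φ m).right_inv hs']

theorem IsCompatible.contMDiff (hD : D.IsCompatible) :
    ContMDiff 𝓘(ℝ, S) 𝓘(ℝ, V) ω D.ι :=
  have := hD.isManifold
  hD.isSmoothEmbedding.contMDiff

/-- A slice chart extends to the analytic map `p ∘ Φ` on an ambient neighbourhood, so analyticity
into `M` can be tested in `V`. Continuity comes from `ι` being an embedding. -/
theorem IsCompatible.contMDiffAt_of_comp (hD : D.IsCompatible) {E' H' N : Type*}
    [NormedAddCommGroup E'] [NormedSpace ℝ E'] [TopologicalSpace H']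
    {I : ModelWithCorners ℝ E' H'} [TopologicalSpace N] [ChartedSpace H' N] {f : N → M} {x : N}
    (h : ContMDiffAt I 𝓘(ℝ, V) ω (D.ι ∘ f) x) : ContMDiffAt I 𝓘(ℝ, S) ω f x := by
  rw [contMDiffAt_iff_target]
  refine ⟨D.isEmbedding.continuousAt_iff.2 h.continuousAt, ?_⟩
  have h1 : ContDiffAt ℝ ω (fun v => D.p (D.Φ (f x) v)) (D.ι (f x)) :=
    D.p.contDiff.contDiffAt.comp _ ((D.contDiffOn (f x)).contDiffAt
      ((D.Φ (f x)).open_source.mem_nhds (D.mem_source (f x))))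
  have h2 := h1.contMDiffAt.comp x h
  refine h2.congr_of_eventuallyEq (Filter.Eventually.of_forall fun y => ?_)
  simp only [extChartAt, hD.chartAt_eq, Function.comp_apply, OpenPartialHomeomorph.extend_coe,
    modelWithCornersSelf_coe, id, chart_apply]

theorem IsCompatible.contMDiff_of_comp (hD : D.IsCompatible) {E' H' N : Type*}
    [NormedAddCommGroup E'] [NormedSpace ℝ E'] [TopologicalSpace H']
    {I : ModelWithCorners ℝ E' H'} [TopologicalSpace N] [ChartedSpace H' N] {f : N → M}
    (h : ContMDiff I 𝓘(ℝ, V) ω (D.ι ∘ f)) : ContMDiff I 𝓘(ℝ, S) ω f :=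
  fun x => hD.contMDiffAt_of_comp (h x)

theorem IsCompatible.hasMFDerivAt (hD : D.IsCompatible) (m : M) {L : V →L[ℝ] V}
    (hL : HasFDerivAt (D.Φ m).symm L (D.Φ m (D.ι m))) :
    HasMFDerivAt 𝓘(ℝ, S) 𝓘(ℝ, V) D.ι m (L ∘L D.j) := by
  refine ⟨D.isEmbedding.continuous.continuousAt, ?_⟩
  have hm := D.mem_chart_source m
  have hc : D.j (D.chart m m) = D.Φ m (D.ι m) := D.j_p hm
  have h1 : HasFDerivAt (fun s => (D.Φ m).symm (D.j s)) (L ∘L D.j) (D.chart m m) := by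
    rw [← hc] at hL
    exact hL.comp _ D.j.hasFDerivAt
  have e1 : writtenInExtChartAt 𝓘(ℝ, S) 𝓘(ℝ, V) m D.ι = D.ι ∘ (D.chart m).symm := by
    rw [writtenInExtChartAt, extChartAt_model_space_eq_id, extChartAt, hD.chartAt_eq]
    simp
  have e2 : extChartAt 𝓘(ℝ, S) m m = D.chart m m := by
    simp [extChartAt, hD.chartAt_eq]
  have h2 : HasFDerivAt (D.ι ∘ (D.chart m).symm) (L ∘L D.j) (D.chart m m) := by
    refine h1.congr_of_eventuallyEq ?_
    filter_upwards [(D.chart m).open_target.mem_nhds ((D.chart m).map_source hm)] with s hs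
    exact D.ι_chart_symm hs
  have h3 := h2.hasFDerivWithinAt (s := range 𝓘(ℝ, S))
  rw [← e1, ← e2] at h3
  exact h3

end SliceData

end Slice

/-! ### Homogeneous spaces of Banach–Lie groups -/

section Homogeneous

open Set Topology

variable {E F L G : Type*} [NormedAddCommGroup E] [NormedSpace ℝ E]
  [NormedAddCommGroup F] [NormedSpace ℝ F] [NormedAddCommGroup L] [NormedSpace ℝ L]
  [Group G] [TopologicalSpace G] [ChartedSpace E G]

/-- Product coordinates `F × L → G` near `1` that are adapted to the cosets of a subgroup `K`. -/
structure CosetSlice (F L : Type*) [NormedAddCommGroup F] [NormedSpace ℝ F]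
    [NormedAddCommGroup L] [NormedSpace ℝ L] (K : Subgroup G) where
  Θ : OpenPartialHomeomorph (F × L) G
  W : Set F
  U : Set L
  isOpen_W : IsOpen W
  isOpen_U : IsOpen U
  zero_mem_W : 0 ∈ W
  zero_mem_U : 0 ∈ U
  source_eq : Θ.source = W ×ˢ U
  map_zero : Θ 0 = 1
  contMDiffOn : ContMDiffOn 𝓘(ℝ, F × L) 𝓘(ℝ, E) ω Θ Θ.source
  contMDiffOn_symm : ContMDiffOn 𝓘(ℝ, E) 𝓘(ℝ, F × L) ω Θ.symm Θ.target
  mem_iff : ∀ p ∈ Θ.source, ∀ q ∈ Θ.source, (Θ p)⁻¹ * Θ q ∈ K ↔ p.1 = q.1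

/-- A global parametrization of a neighbourhood of `1` that linearizes `K` yields product
coordinates, by the inverse function theorem. -/
theorem exists_cosetSlice [CompleteSpace F] [CompleteSpace L] [LieGroup 𝓘(ℝ, E) ω G] (K : Subgroup G)
    (φ : OpenPartialHomeomorph G E) (hφ : φ ∈ IsManifold.maximalAtlas 𝓘(ℝ, E) ω G)
    (h1 : 1 ∈ φ.source) (hφ1 : φ 1 = 0) (ht : φ.target = univ) (e : (F × L) ≃L[ℝ] E)
    (hK : ∀ x, φ.symm (e x) ∈ K ↔ x.1 = 0) :
    Nonempty (CosetSlice (E := E) F L K) := by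
  have : IsTopologicalGroup G := topologicalGroup_of_lieGroup 𝓘(ℝ, E) ω
  let c : E → G := φ.symm
  have hc : ContMDiff 𝓘(ℝ, E) 𝓘(ℝ, E) ω c := by
    rw [← contMDiffOn_univ, ← ht]
    exact contMDiffOn_symm_of_mem_maximalAtlas hφ
  have hc0 : c 0 = 1 := by rw [← hφ1]; exact φ.left_inv h1
  have hφc : ∀ x, φ (c x) = x := fun x => φ.right_inv (ht ▸ mem_univ x)
  have hcs : ∀ x, c x ∈ φ.source := fun x => φ.map_target (ht ▸ mem_univ x)
  -- The second factor lies in `K`, so the coset of `P (k, l)` depends on `k` alone.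
  let P : F × L → G := fun p => c (e (p.1, 0)) * c (e (0, p.2))
  have hP : ContMDiff 𝓘(ℝ, F × L) 𝓘(ℝ, E) ω P := by
    refine ContMDiff.mul (hc.comp ?_) (hc.comp ?_) <;>
    · rw [contMDiff_iff_contDiff]
      fun_prop
  have hPl : ∀ k, P (k, 0) = c (e (k, 0)) := fun k => by
    change c (e (k, 0)) * c (e (0, 0)) = _
    rw [← Prod.zero_eq_mk, map_zero, hc0, mul_one]
  have hPr : ∀ h, P (0, h) = c (e (0, h)) := fun h => by
    change c (e (0, 0)) * c (e (0, h)) = _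
    rw [← Prod.zero_eq_mk, map_zero, hc0, one_mul]
  have hP0 : P 0 = 1 := by rw [Prod.zero_eq_mk, hPl, ← Prod.zero_eq_mk, map_zero, hc0]
  let m : F × L → E := fun p => φ (P p)
  have hm : ContDiffAt ℝ ω m 0 := by
    rw [← contMDiffAt_iff_contDiffAt]
    refine ContMDiffAt.comp (0 : F × L) ?_ (hP 0)
    exact contMDiffAt_of_mem_maximalAtlas hφ (by rwa [hP0])
  -- In the chart, `P` agrees with the linear map `e` on each of the two axes, which determines the
  -- derivative at `0`.
  have hm' : HasFDerivAt m (e : F × L →L[ℝ] E) 0 := by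
    have hd := (hm.differentiableAt (by simp)).hasFDerivAt
    have hl : (fderiv ℝ m 0).comp (ContinuousLinearMap.inl ℝ F L)
        = (e : F × L →L[ℝ] E).comp (ContinuousLinearMap.inl ℝ F L) := by
      have h2 : HasFDerivAt (m ∘ ContinuousLinearMap.inl ℝ F L)
          ((fderiv ℝ m 0).comp (ContinuousLinearMap.inl ℝ F L)) 0 := by
        refine HasFDerivAt.comp 0 ?_ (ContinuousLinearMap.hasFDerivAt _)
        exact hd
      have h3 : m ∘ ContinuousLinearMap.inl ℝ F L
          = (e : F × L →L[ℝ] E).comp (ContinuousLinearMap.inl ℝ F L) := by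
        ext k
        change φ (P (k, 0)) = e (k, 0)
        rw [hPl, hφc]
      rw [h3] at h2
      exact h2.unique (ContinuousLinearMap.hasFDerivAt _)
    have hr : (fderiv ℝ m 0).comp (ContinuousLinearMap.inr ℝ F L)
        = (e : F × L →L[ℝ] E).comp (ContinuousLinearMap.inr ℝ F L) := by
      have h2 : HasFDerivAt (m ∘ ContinuousLinearMap.inr ℝ F L)
          ((fderiv ℝ m 0).comp (ContinuousLinearMap.inr ℝ F L)) 0 := by
        refine HasFDerivAt.comp 0 ?_ (ContinuousLinearMap.hasFDerivAt _)
        exact hd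
      have h3 : m ∘ ContinuousLinearMap.inr ℝ F L
          = (e : F × L →L[ℝ] E).comp (ContinuousLinearMap.inr ℝ F L) := by
        ext k
        change φ (P (0, k)) = e (0, k)
        rw [hPr, hφc]
      rw [h3] at h2
      exact h2.unique (ContinuousLinearMap.hasFDerivAt _)
    rwa [ContinuousLinearMap.prod_ext hl hr] at hd
  let θ := hm.toOpenPartialHomeomorph m hm' (by simp)
  have hθ : ∀ p, θ p = m p := fun _ => rfl
  have hθ0 : (0 : F × L) ∈ θ.source :=
    hm.mem_toOpenPartialHomeomorph_source hm' (by simp)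
  have hθs : ContDiffAt ℝ ω θ.symm (m 0) := hm.to_localInverse hm' (by simp)
  have hA : ∀ᶠ p in 𝓝 (0 : F × L), p ∈ θ.source ∧ P p ∈ φ.source := by
    refine (θ.open_source.eventually_mem hθ0).and ?_
    exact hP.continuous.continuousAt.eventually (φ.open_source.mem_nhds (by rwa [hP0]))
  have hB : ∀ᶠ p in 𝓝 (0 : F × L), ContDiffAt ℝ ω θ.symm (m p) :=
    hm.continuousAt.eventually (hθs.eventually (by simp))
  let v : F × F → G := fun k => (c (e (k.1, 0)))⁻¹ * c (e (k.2, 0))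
  have hv : Continuous v := by
    have := hc.continuous
    fun_prop
  have hv0 : v 0 = 1 := by
    change (c (e (0, 0)))⁻¹ * c (e (0, 0)) = 1
    simp
  have hC1 : ∀ᶠ k in 𝓝 (0 : F × F), v k ∈ φ.source :=
    hv.continuousAt.eventually (φ.open_source.mem_nhds (by rwa [hv0]))
  -- For small `k₁`, `k₂`, the point with first coordinate `k₁` and second coordinate read off from
  -- `c(k₁)⁻¹ c(k₂)` must lie where `θ` is injective; the last part of the proof compares it with
  -- `(k₂, 0)`.
  have hC2 : ∀ᶠ k in 𝓝 (0 : F × F),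
      (k.1, (e.symm (φ (v k))).2) ∈ θ.source ∧ P (k.1, (e.symm (φ (v k))).2) ∈ φ.source := by
    have hcont : ContinuousAt (fun k : F × F => (k.1, (e.symm (φ (v k))).2)) 0 := by
      have h2 : ContinuousAt (fun k => φ (v k)) 0 :=
        ContinuousAt.comp (φ.continuousAt (by rwa [hv0])) hv.continuousAt
      exact continuousAt_fst.prodMk
        (continuous_snd.continuousAt.comp (e.symm.continuous.continuousAt.comp h2))
    refine hcont.eventually (Filter.Eventually.filter_mono (le_of_eq ?_) hA)
    simp [hv0, hφ1]
  obtain ⟨W₁, hW₁, W₂, hW₂, hW₁₂⟩ := Filter.eventually_prod_iff.1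
    ((nhds_prod_eq (x := (0 : F)) (y := (0 : F))) ▸ (hC1.and hC2))
  obtain ⟨W₃, U, hW₃, h0W₃, hU, h0U, hWU⟩ := mem_nhds_prod_iff'.1 (hA.and hB)
  obtain ⟨W₄, hW₄sub, hW₄, h0W₄⟩ := mem_nhds_iff.1 (hW₁.and hW₂)
  let W := W₃ ∩ W₄
  have hW : IsOpen W := hW₃.inter hW₄
  have h0W : (0 : F) ∈ W := ⟨h0W₃, h0W₄⟩
  have hWN : ∀ p ∈ W ×ˢ U, (p ∈ θ.source ∧ P p ∈ φ.source) ∧ ContDiffAt ℝ ω θ.symm (m p) :=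
    fun p hp => hWU ⟨hp.1.1, hp.2⟩
  let Θ := (θ.restrOpen (W ×ˢ U) (hW.prod hU)).trans φ.symm
  have hsrc : Θ.source = W ×ˢ U := by
    ext p
    simp only [Θ, OpenPartialHomeomorph.trans_source, OpenPartialHomeomorph.symm_source, ht,
      preimage_univ, inter_univ, OpenPartialHomeomorph.restrOpen_source]
    exact ⟨fun h => h.2, fun h => ⟨(hWN p h).1.1, h⟩⟩
  have hΘ : ∀ p ∈ W ×ˢ U, Θ p = P p := fun p hp => φ.left_inv (hWN p hp).1.2
  have hKr : ∀ h, c (e (0, h)) ∈ K := fun h => (hK (0, h)).2 rfl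
  refine ⟨⟨Θ, W, U, hW, hU, h0W, h0U, hsrc, ?_, ?_, ?_, ?_⟩⟩
  · rw [hΘ 0 ⟨h0W, h0U⟩, hP0]
  · rw [hsrc]
    exact hP.contMDiffOn.congr hΘ
  · intro g hg
    have hp := Θ.map_target hg
    rw [hsrc] at hp
    have hg' : P (Θ.symm g) = g := by rw [← hΘ _ hp, Θ.right_inv hg]
    have h2 : ContMDiffAt 𝓘(ℝ, E) 𝓘(ℝ, F × L) ω (θ.symm ∘ φ) g := by
      refine ContMDiffAt.comp g ?_ (contMDiffAt_of_mem_maximalAtlas hφ ?_)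
      · rw [contMDiffAt_iff_contDiffAt, ← hg']
        exact (hWN _ hp).2
      · rw [← hg']
        exact (hWN _ hp).1.2
    exact h2.contMDiffWithinAt
  · intro p hp q hq
    rw [hsrc] at hp hq
    -- The outer factors belong to `K`, so only the middle one decides membership.
    have h2 : (Θ p)⁻¹ * Θ q = (c (e (0, p.2)))⁻¹ * v (p.1, q.1) * c (e (0, q.2)) := by
      rw [hΘ p hp, hΘ q hq]
      simp only [P, v]
      group
    rw [h2, K.mul_mem_cancel_right (hKr _), K.mul_mem_cancel_left (K.inv_mem (hKr _))]
    constructor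
    · intro h3
      obtain ⟨h4, h5, h6⟩ := hW₁₂ (hW₄sub hp.1.2).1 (hW₄sub hq.1.2).2
      -- If `v = c(p.1)⁻¹ c(q.1)` lies in `K`, it equals `c (e (0, x.2))`. Then `P (p.1, x.2) = P
      -- (q.1, 0)`, and injectivity of `θ` gives `p.1 = q.1`.
      set x := e.symm (φ (v (p.1, q.1))) with hx
      have h7 : c (e x) = v (p.1, q.1) := by
        rw [hx, e.apply_symm_apply]
        exact φ.left_inv h4
      have h8 : x.1 = 0 := (hK x).1 (by rw [← h7] at h3; exact h3)
      have h9 : P (p.1, x.2) = P (q.1, 0) := by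
        have h10 : ((0 : F), x.2) = x := Prod.ext h8.symm rfl
        rw [hPl]
        change c (e (p.1, 0)) * c (e (0, x.2)) = _
        rw [h10, h7]
        simp [v]
      have h11 := θ.injOn h5 (hWN (q.1, 0) ⟨hq.1, h0U⟩).1.1 (congrArg φ h9)
      have h12 := congrArg Prod.fst h11
      exact h12
    · intro h3
      simp [v, h3, K.one_mem]

end Homogeneous

/-! ### Analytic structure on a homogeneous space from a coset slice. -/

section Homogeneous

open Set Topology

variable {E F L G : Type*} [NormedAddCommGroup E] [NormedSpace ℝ E]
  [NormedAddCommGroup F] [NormedSpace ℝ F] [NormedAddCommGroup L] [NormedSpace ℝ L]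
  [Group G] [TopologicalSpace G] [ChartedSpace E G]

/-- A homogeneous space of `G`, with the quotient topology, together with a slice of the cosets of
the stabilizer of a point. -/
structure HomogeneousData (F L G X : Type*) [NormedAddCommGroup F] [NormedSpace ℝ F]
    [NormedAddCommGroup L] [NormedSpace ℝ L] [Group G] [TopologicalSpace G] [ChartedSpace E G]
    [TopologicalSpace X] [MulAction G X] where
  base : X
  isQuotientMap : IsQuotientMap fun g : G => g • base
  slice : CosetSlice (E := E) F L (MulAction.stabilizer G base)

namespace HomogeneousData

variable {X : Type*} [TopologicalSpace X] [MulAction G X] (D : HomogeneousData (E := E) F L G X)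

theorem continuous_smul_base : Continuous fun g : G => g • D.base := D.isQuotientMap.continuous

theorem smul_base_eq_iff (g h : G) :
    g • D.base = h • D.base ↔ g⁻¹ * h ∈ MulAction.stabilizer G D.base := by
  rw [MulAction.mem_stabilizer_iff, mul_smul, inv_smul_eq_iff, eq_comm]

/-- The saturation of an open set is the union of its right translates by the stabilizer, hence
open. -/
theorem isOpenMap_smul_base [IsTopologicalGroup G] : IsOpenMap fun g : G => g • D.base := by
  intro U hU
  rw [← D.isQuotientMap.isOpen_preimage]
  have h : (fun g : G => g • D.base) ⁻¹' ((fun g : G => g • D.base) '' U)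
      = ⋃ k ∈ MulAction.stabilizer G D.base, (fun g => g * k) ⁻¹' U := by
    ext g
    simp only [mem_preimage, mem_image, mem_iUnion, exists_prop]
    constructor
    · rintro ⟨u, hu, h⟩
      exact ⟨g⁻¹ * u, (D.smul_base_eq_iff g u).1 h.symm, by simpa using hu⟩
    · rintro ⟨k, hk, h⟩
      exact ⟨g * k, h, by rw [mul_smul, MulAction.mem_stabilizer_iff.1 hk]⟩
  rw [h]
  exact isOpen_biUnion fun k _ => hU.preimage (continuous_mul_const k)

theorem continuousConstSMul [IsTopologicalGroup G] (D : HomogeneousData (E := E) F L G X) :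
    ContinuousConstSMul G X where
  continuous_const_smul g := by
    rw [D.isQuotientMap.continuous_iff]
    have h : (fun x : X => g • x) ∘ (fun h : G => h • D.base)
        = (fun h : G => h • D.base) ∘ fun h => g * h := by
      ext h
      exact (mul_smul g h D.base).symm
    rw [h]
    exact D.continuous_smul_base.comp (continuous_const_mul g)

theorem mem_source {k : F} (hk : k ∈ D.slice.W) {l : L} (hl : l ∈ D.slice.U) :
    (k, l) ∈ D.slice.Θ.source := by
  rw [D.slice.source_eq]
  exact ⟨hk, hl⟩

theorem slice_smul_base_eq_iff {p q : F × L} (hp : p ∈ D.slice.Θ.source)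
    (hq : q ∈ D.slice.Θ.source) :
    D.slice.Θ p • D.base = D.slice.Θ q • D.base ↔ p.1 = q.1 := by
  rw [smul_base_eq_iff, D.slice.mem_iff p hp q hq]

/-- The local parametrization of the homogeneous space near the base point. -/
def param [IsTopologicalGroup G] : OpenPartialHomeomorph F X :=
  let e : PartialEquiv F X :=
    InjOn.toPartialEquiv (fun k => D.slice.Θ (k, 0) • D.base) D.slice.W fun _ hk _ hk' h =>
      (D.slice_smul_base_eq_iff (D.mem_source hk D.slice.zero_mem_U)
        (D.mem_source hk' D.slice.zero_mem_U)).1 h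
  OpenPartialHomeomorph.ofContinuousOpenRestrict e
    (D.continuous_smul_base.comp_continuousOn (D.slice.Θ.continuousOn.comp
      (Continuous.prodMk_left 0).continuousOn fun _ hk => D.mem_source hk D.slice.zero_mem_U))
    (by
      intro O hO
      have hO' : IsOpen (Subtype.val '' O : Set F) := D.slice.isOpen_W.isOpenMap_subtype_val O hO
      have hsub : (Subtype.val '' O : Set F) ×ˢ D.slice.U ⊆ D.slice.Θ.source := by
        rw [D.slice.source_eq]
        refine prod_mono ?_ subset_rfl
        rintro _ ⟨k, -, rfl⟩
        exact k.2
      -- The second slice coordinate does not affect the orbit point, so `O` may be thickened to the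
      -- open set `O × U`; its image is open because `Θ` and the orbit map are open.
      have h : e.source.domRestrict e '' O = (fun g : G => g • D.base) ''
          (D.slice.Θ '' ((Subtype.val '' O : Set F) ×ˢ D.slice.U)) := by
        ext x
        constructor
        · rintro ⟨k, hk, rfl⟩
          exact ⟨_, ⟨(k, 0), ⟨⟨k, hk, rfl⟩, D.slice.zero_mem_U⟩, rfl⟩, rfl⟩
        · rintro ⟨_, ⟨⟨_, l⟩, ⟨⟨k, hk, rfl⟩, hl⟩, rfl⟩, rfl⟩
          refine ⟨k, hk, (D.slice_smul_base_eq_iff ?_ ?_).2 rfl⟩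
          · exact D.mem_source k.2 D.slice.zero_mem_U
          · exact D.mem_source k.2 hl
      rw [h]
      exact D.isOpenMap_smul_base _ (D.slice.Θ.isOpen_image_of_subset_source
        (hO'.prod D.slice.isOpen_U) hsub))
    D.slice.isOpen_W

theorem param_source [IsTopologicalGroup G] : D.param.source = D.slice.W := rfl

theorem param_apply [IsTopologicalGroup G] (k : F) :
    D.param k = D.slice.Θ (k, 0) • D.base := rfl

theorem param_zero [IsTopologicalGroup G] : D.param 0 = D.base := by
  rw [param_apply, ← Prod.zero_eq_mk, D.slice.map_zero, one_smul]

theorem slice_smul_base [IsTopologicalGroup G] {p : F × L} (hp : p ∈ D.slice.Θ.source) :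
    D.slice.Θ p • D.base = D.param p.1 := by
  have hp' := hp
  rw [D.slice.source_eq] at hp'
  exact (D.slice_smul_base_eq_iff hp (D.mem_source hp'.1 D.slice.zero_mem_U)).2 rfl

theorem mem_param_target [IsTopologicalGroup G] {p : F × L} (hp : p ∈ D.slice.Θ.source) :
    D.slice.Θ p • D.base ∈ D.param.target := by
  rw [D.slice_smul_base hp]
  have hp' := hp
  rw [D.slice.source_eq] at hp'
  exact D.param.map_source hp'.1

theorem param_symm_slice [IsTopologicalGroup G] {p : F × L} (hp : p ∈ D.slice.Θ.source) :
    D.param.symm (D.slice.Θ p • D.base) = p.1 := by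
  rw [D.slice_smul_base hp]
  have hp' := hp
  rw [D.slice.source_eq] at hp'
  exact D.param.left_inv hp'.1

/-- The chart of the homogeneous space centered at `g • base`. -/
def chart [IsTopologicalGroup G] [ContinuousConstSMul G X] (g : G) : OpenPartialHomeomorph X F :=
  (Homeomorph.smul g⁻¹).toOpenPartialHomeomorph.trans D.param.symm

variable [IsTopologicalGroup G] [ContinuousConstSMul G X]

theorem chart_apply (g : G) (x : X) : D.chart g x = D.param.symm (g⁻¹ • x) := rfl

theorem chart_symm_apply (g : G) (k : F) : (D.chart g).symm k = g • D.param k := by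
  change g⁻¹⁻¹ • D.param k = _
  rw [inv_inv]

theorem mem_chart_source {g : G} {x : X} :
    x ∈ (D.chart g).source ↔ g⁻¹ • x ∈ D.param.target := by
  simp [chart]

theorem mem_chart_target {g : G} {k : F} : k ∈ (D.chart g).target ↔ k ∈ D.slice.W := by
  simp [chart, param_source]

/-- A group element moving the base point to a given point. -/
def lift (x : X) : G := (D.isQuotientMap.surjective x).choose

omit [IsTopologicalGroup G] [ContinuousConstSMul G X] in
theorem lift_smul_base (x : X) : D.lift x • D.base = x := (D.isQuotientMap.surjective x).choose_spec

theorem smul_base_mem_chart_source (g : G) : g • D.base ∈ (D.chart g).source := by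
  rw [mem_chart_source, inv_smul_smul, ← D.param_zero]
  exact D.param.map_source D.slice.zero_mem_W

/-- The atlas of translates of the local parametrization. -/
@[reducible] def chartedSpace : ChartedSpace F X where
  atlas := range D.chart
  chartAt x := D.chart (D.lift x)
  mem_chart_source x := by
    have h := D.smul_base_mem_chart_source (D.lift x)
    rwa [lift_smul_base] at h
  chart_mem_atlas x := mem_range_self _

/-- The charted space structure of `X` is the one of the translated parametrizations. -/
structure IsCompatible [ChartedSpace F X] : Prop where
  chartAt_eq : ∀ x, chartAt F x = D.chart (D.lift x)
  atlas_eq : atlas F X = range D.chart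

variable [LieGroup 𝓘(ℝ, E) ω G]

omit [ContinuousConstSMul G X] in
-- An element `g` over the parametrized region need not lie in the range of `Θ`, but `g v` does for
-- some `v` in the stabilizer. Right multiplication by this fixed `v` is analytic and preserves the
-- orbit point. Near `g` the map is therefore the first coordinate of `Θ⁻¹ (· v)`.
theorem contMDiffOn_param_symm :
    ContMDiffOn 𝓘(ℝ, E) 𝓘(ℝ, F) ω (fun g : G => D.param.symm (g • D.base))
      {g | g • D.base ∈ D.param.target} := by
  intro g hg
  have hk := D.param.map_target hg
  have hs := D.mem_source hk D.slice.zero_mem_U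
  set k := D.param.symm (g • D.base) with hkdef
  have h1 : D.slice.Θ (k, 0) • D.base = g • D.base := D.param.right_inv hg
  have h2 := (D.smul_base_eq_iff _ _).1 h1.symm
  set v := g⁻¹ * D.slice.Θ (k, 0) with hv
  have hgv : g * v = D.slice.Θ (k, 0) := by simp [hv]
  have hgt : g * v ∈ D.slice.Θ.target := by
    rw [hgv]; exact D.slice.Θ.map_source hs
  have h3 : ContMDiffAt 𝓘(ℝ, E) 𝓘(ℝ, F) ω (fun g' : G => (D.slice.Θ.symm (g' * v)).1) g := by
    have h4 : ContMDiffAt 𝓘(ℝ, E) 𝓘(ℝ, F × L) ω (D.slice.Θ.symm ∘ fun g' : G => g' * v) g :=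
      ContMDiffAt.comp g (D.slice.contMDiffOn_symm.contMDiffAt
        (D.slice.Θ.open_target.mem_nhds hgt)) (contMDiff_mul_right (a := v)).contMDiffAt
    exact (contDiff_fst (𝕜 := ℝ) (E := F) (F := L)).contMDiff.contMDiffAt.comp g h4
  refine (h3.congr_of_eventuallyEq ?_).contMDiffWithinAt
  have h5 : ∀ᶠ g' in 𝓝 g, g' * v ∈ D.slice.Θ.target :=
    (continuous_mul_const v).continuousAt.eventually (D.slice.Θ.open_target.mem_nhds hgt)
  filter_upwards [h5] with g' hg'
  have h6 : g' • D.base = (g' * v) • D.base := by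
    rw [mul_smul, MulAction.mem_stabilizer_iff.1 h2]
  rw [h6]
  conv_lhs => rw [← D.slice.Θ.right_inv hg']
  exact D.param_symm_slice (D.slice.Θ.map_target hg')

/-- The coordinate of `g⁻¹ h • base` depends analytically on `h`. -/
theorem contMDiffOn_chart_smul_base (g : G) :
    ContMDiffOn 𝓘(ℝ, E) 𝓘(ℝ, F) ω (fun h : G => D.chart g (h • D.base))
      {h | h • D.base ∈ (D.chart g).source} := by
  have h1 : ContMDiffOn 𝓘(ℝ, E) 𝓘(ℝ, F) ω
      ((fun g : G => D.param.symm (g • D.base)) ∘ fun h : G => g⁻¹ * h)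
      {h | h • D.base ∈ (D.chart g).source} := by
    refine D.contMDiffOn_param_symm.comp (contMDiff_mul_left (a := g⁻¹)).contMDiffOn fun h hh => ?_
    rw [mem_ofPred_eq, D.mem_chart_source, ← mul_smul] at hh
    exact hh
  refine h1.congr fun h _ => ?_
  rw [chart_apply, ← mul_smul]
  rfl

omit [IsTopologicalGroup G] [ContinuousConstSMul G X] in
theorem contMDiffOn_slice (g : G) :
    ContMDiffOn 𝓘(ℝ, F) 𝓘(ℝ, E) ω (fun k => g * D.slice.Θ (k, 0)) D.slice.W := by
  refine (contMDiff_mul_left (a := g)).comp_contMDiffOn (D.slice.contMDiffOn.comp ?_ fun k hk =>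
    D.mem_source hk D.slice.zero_mem_U)
  rw [contMDiffOn_iff_contDiffOn]
  fun_prop

omit [LieGroup 𝓘(ℝ, E) ω G] in
theorem chart_symm_eq (g : G) (k : F) :
    (D.chart g).symm k = (g * D.slice.Θ (k, 0)) • D.base := by
  rw [chart_symm_apply, param_apply, mul_smul]

variable {D} [ChartedSpace F X]

theorem IsCompatible.isManifold (hD : D.IsCompatible) : IsManifold 𝓘(ℝ, F) ω X := by
  refine isManifold_of_contDiffOn _ _ _ fun e e' he he' => ?_
  rw [hD.atlas_eq] at he he'
  obtain ⟨g, rfl⟩ := he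
  obtain ⟨g', rfl⟩ := he'
  have h : ContMDiffOn 𝓘(ℝ, F) 𝓘(ℝ, F) ω
      ((fun h : G => D.chart g' (h • D.base)) ∘ fun k => g * D.slice.Θ (k, 0))
      ((D.chart g).symm ≫ₕ D.chart g').source := by
    refine (D.contMDiffOn_chart_smul_base g').comp
      ((D.contMDiffOn_slice g).mono fun k hk => ?_) fun k hk => ?_
    · rw [OpenPartialHomeomorph.trans_source] at hk
      exact D.mem_chart_target.1 hk.1
    · rw [OpenPartialHomeomorph.trans_source] at hk
      have h2 : (D.chart g).symm k ∈ (D.chart g').source := hk.2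
      rwa [chart_symm_eq] at h2
  simp only [modelWithCornersSelf_coe, modelWithCornersSelf_coe_symm,
    preimage_id, range_id, inter_univ, CompTriple.comp_eq]
  refine h.contDiffOn.congr fun k hk => ?_
  rw [OpenPartialHomeomorph.coe_trans, Function.comp_apply, chart_symm_eq]
  rfl

theorem IsCompatible.chart_mem_maximalAtlas (hD : D.IsCompatible) (g : G) :
    D.chart g ∈ IsManifold.maximalAtlas 𝓘(ℝ, F) ω X := by
  have := hD.isManifold
  refine IsManifold.subset_maximalAtlas ?_
  rw [hD.atlas_eq]
  exact mem_range_self g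

theorem IsCompatible.contMDiff_smul_base (hD : D.IsCompatible) :
    ContMDiff 𝓘(ℝ, E) 𝓘(ℝ, F) ω fun g : G => g • D.base := by
  intro g
  rw [contMDiffAt_iff_target]
  refine ⟨D.continuous_smul_base.continuousAt, ?_⟩
  set g' := D.lift (g • D.base)
  have hg : g • D.base ∈ (D.chart g').source := by
    have h := D.smul_base_mem_chart_source g'
    rwa [lift_smul_base] at h
  have h1 := (D.contMDiffOn_chart_smul_base g').contMDiffAt
    (((D.chart g').open_source.preimage D.continuous_smul_base).mem_nhds hg)
  refine h1.congr_of_eventuallyEq (Filter.Eventually.of_forall fun h => ?_)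
  simp [extChartAt, hD.chartAt_eq, g']

/-- Near each point there is an analytic local section of `g ↦ g • base`. -/
theorem IsCompatible.exists_section (hD : D.IsCompatible) (x : X) :
    ∃ σ : X → G, ContMDiffAt 𝓘(ℝ, F) 𝓘(ℝ, E) ω σ x ∧ ∀ᶠ y in 𝓝 x, σ y • D.base = y := by
  have := hD.isManifold
  set g := D.lift x
  have hx : x ∈ (D.chart g).source := by
    have h := D.smul_base_mem_chart_source g
    rwa [lift_smul_base] at h
  refine ⟨(fun k => g * D.slice.Θ (k, 0)) ∘ D.chart g, ?_, ?_⟩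
  · refine ContMDiffAt.comp x ((D.contMDiffOn_slice g).contMDiffAt ?_)
      (contMDiffAt_of_mem_maximalAtlas (hD.chart_mem_maximalAtlas g) hx)
    exact D.slice.isOpen_W.mem_nhds (D.mem_chart_target.1 ((D.chart g).map_source hx))
  · filter_upwards [(D.chart g).open_source.mem_nhds hx] with y hy
    rw [Function.comp_apply, ← chart_symm_eq, (D.chart g).left_inv hy]

/-- With a local section `σ`, the action is locally `(g, y) ↦ (g σ(y)) • base`: a group product
followed by the orbit map. -/
theorem IsCompatible.contMDiffSMul (hD : D.IsCompatible) :
    ContMDiffSMul 𝓘(ℝ, E) 𝓘(ℝ, F) ω G X where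
  contMDiff_smul := by
    rintro ⟨g, x⟩
    obtain ⟨σ, hσ, hσ'⟩ := hD.exists_section x
    have h1 : ContMDiffAt (𝓘(ℝ, E).prod 𝓘(ℝ, F)) 𝓘(ℝ, E) ω
        (fun p : G × X => p.1 * σ p.2) (g, x) := by
      refine ContMDiffAt.mul contMDiffAt_fst ?_
      exact ContMDiffAt.comp (g, x) hσ contMDiffAt_snd
    have h2 := (hD.contMDiff_smul_base (g * σ x)).comp (g, x) h1
    refine h2.congr_of_eventuallyEq ?_
    have h3 : ∀ᶠ p : G × X in 𝓝 (g, x), σ p.2 • D.base = p.2 :=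
      (continuous_snd.tendsto (g, x)).eventually hσ'
    filter_upwards [h3] with p hp
    rw [Function.comp_apply, mul_smul, hp]

/-- The chart of `G` near `g` adapted to the slice. -/
def groupChart (D : HomogeneousData (E := E) F L G X) (e : (F × L) ≃L[ℝ] E) (g : G) :
    OpenPartialHomeomorph G E :=
  ((Homeomorph.mulLeft g⁻¹).toOpenPartialHomeomorph.trans D.slice.Θ.symm).trans
    e.toHomeomorph.toOpenPartialHomeomorph

omit [LieGroup 𝓘(ℝ, E) ω G] [ContinuousConstSMul G X] [ChartedSpace F X] in
theorem mem_groupChart_source {e : (F × L) ≃L[ℝ] E} {g h : G} :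
    h ∈ (D.groupChart e g).source ↔ g⁻¹ * h ∈ D.slice.Θ.target := by
  simp [groupChart]

omit [LieGroup 𝓘(ℝ, E) ω G] [ContinuousConstSMul G X] [ChartedSpace F X] in
theorem mem_groupChart_target {e : (F × L) ≃L[ℝ] E} {g : G} {y : E} :
    y ∈ (D.groupChart e g).target ↔ e.symm y ∈ D.slice.Θ.source := by
  simp [groupChart]

omit [LieGroup 𝓘(ℝ, E) ω G] [ContinuousConstSMul G X] [ChartedSpace F X] in
theorem groupChart_symm_apply {e : (F × L) ≃L[ℝ] E} {g : G} (y : E) :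
    (D.groupChart e g).symm y = g * D.slice.Θ (e.symm y) := by
  change g⁻¹⁻¹ * D.slice.Θ (e.symm y) = _
  rw [inv_inv]

omit [ContinuousConstSMul G X] [ChartedSpace F X] in
theorem groupChart_mem_maximalAtlas (e : (F × L) ≃L[ℝ] E) (g : G) :
    D.groupChart e g ∈ IsManifold.maximalAtlas 𝓘(ℝ, E) ω G := by
  refine OpenPartialHomeomorph.mem_maximalAtlas_of_contMDiffOn _ ?_ ?_
  · have h1 : ContMDiffOn 𝓘(ℝ, E) 𝓘(ℝ, F × L) ω (D.slice.Θ.symm ∘ fun h : G => g⁻¹ * h)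
        (D.groupChart e g).source :=
      D.slice.contMDiffOn_symm.comp (contMDiff_mul_left (a := g⁻¹)).contMDiffOn fun h hh =>
        mem_groupChart_source.1 hh
    exact e.contDiff.contMDiff.comp_contMDiffOn h1
  · have h1 : ContMDiffOn 𝓘(ℝ, E) 𝓘(ℝ, E) ω (D.slice.Θ ∘ e.symm) (D.groupChart e g).target :=
      D.slice.contMDiffOn.comp e.symm.contDiff.contMDiff.contMDiffOn fun y hy =>
        mem_groupChart_target.1 hy
    refine ((contMDiff_mul_left (a := g)).comp_contMDiffOn h1).congr fun y _ => ?_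
    exact groupChart_symm_apply y

/-- In the translated slice coordinates on `G` and on `X`, the orbit map is the projection `(k, l) ↦
k`. -/
theorem IsCompatible.isSubmersionOfComplement (hD : D.IsCompatible) (e : (F × L) ≃L[ℝ] E) :
    Manifold.IsSubmersionOfComplement L 𝓘(ℝ, E) 𝓘(ℝ, F) ω fun g : G => g • D.base := by
  intro g
  have hone : (1 : G) ∈ D.slice.Θ.target := by
    rw [← D.slice.map_zero]
    exact D.slice.Θ.map_source (D.mem_source D.slice.zero_mem_W D.slice.zero_mem_U)
  refine Manifold.IsSubmersionAtOfComplement.mk_of_charts e.symm (D.groupChart e g) (D.chart g)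
    ?_ (D.smul_base_mem_chart_source g) (groupChart_mem_maximalAtlas e g)
    (hD.chart_mem_maximalAtlas g) ?_ ?_
  · rw [mem_groupChart_source, inv_mul_cancel]
    exact hone
  · intro h hh
    rw [mem_groupChart_source] at hh
    rw [mem_preimage, mem_chart_source, ← mul_smul, ← D.slice.Θ.right_inv hh]
    exact D.mem_param_target (D.slice.Θ.map_target hh)
  · intro y hy
    have hy' : e.symm y ∈ D.slice.Θ.source :=
      mem_groupChart_target.1 (by simpa using hy)
    simp only [Function.comp_apply, OpenPartialHomeomorph.extend_coe,
      OpenPartialHomeomorph.extend_coe_symm, modelWithCornersSelf_coe,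
      modelWithCornersSelf_coe_symm, id]
    rw [groupChart_symm_apply, chart_apply, ← mul_smul, inv_mul_cancel_left,
      D.param_symm_slice hy']

end HomogeneousData

end Homogeneous

/-! ### The Cayley transform -/

theorem isUnit_and_ringInverse_eq {R : Type*} [MonoidWithZero R] {a b : R} (h : a * b = 1)
    (h' : b * a = 1) : IsUnit a ∧ Ring.inverse a = b :=
  ⟨⟨⟨a, b, h, h'⟩, rfl⟩, Ring.inverse_unit ⟨a, b, h, h'⟩⟩

theorem Commute.ringInverse_right {R : Type*} [MonoidWithZero R] {a b : R} (h : Commute a b) :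
    Commute a (Ring.inverse b) := by
  by_cases hb : IsUnit b
  · obtain ⟨u, rfl⟩ := hb
    rw [Ring.inverse_unit]
    exact h.units_inv_right
  · rw [Ring.inverse_non_unit _ hb]
    exact Commute.zero_right a

namespace SymmNormedIdeal

open Set Topology

variable {H : Type*} [NormedAddCommGroup H] [InnerProductSpace ℂ H]
  (J : SymmNormedIdeal H)

/-- The Cayley transform `w ↦ w (2 + w)⁻¹` of `1 + w`. -/
def cayley (w : J.Elem) : J.Elem := J.mulR (Ring.inverse (2 + J.toOpL w)) w

/-- The inverse `x ↦ 2 x (1 - x)⁻¹` of the Cayley transform. -/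
def cayleyInv (x : J.Elem) : J.Elem := (2 : ℝ) • J.mulR (Ring.inverse (1 - J.toOpL x)) x

theorem toOp_cayley (w : J.Elem) :
    J.toOp (J.cayley w) = J.toOp w * Ring.inverse (2 + J.toOp w) := rfl

theorem toOp_cayleyInv (x : J.Elem) :
    J.toOp (J.cayleyInv x) = (2 : ℝ) • (J.toOp x * Ring.inverse (1 - J.toOp x)) := by
  rw [cayleyInv, toOp_smul_real]
  rfl

/-- From `1 - w (2 + w)⁻¹ = 2 (2 + w)⁻¹`. Together with the analogous `2 + 2 x (1 - x)⁻¹ = 2 (1 -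
x)⁻¹`, this matches the domains of the two transforms. -/
theorem isUnit_one_sub_cayley {w : J.Elem} (hw : IsUnit (2 + J.toOp w)) :
    IsUnit (1 - J.toOp (J.cayley w)) ∧
      Ring.inverse (1 - J.toOp (J.cayley w)) = (2⁻¹ : ℝ) • (2 + J.toOp w) := by
  have h1 := Ring.mul_inverse_cancel _ hw
  have h2 := Ring.inverse_mul_cancel _ hw
  have h3 : 1 - J.toOp (J.cayley w) = (2 : ℝ) • Ring.inverse (2 + J.toOp w) := by
    rw [toOp_cayley]
    nth_rw 1 [← h1]
    rw [add_mul, add_sub_cancel_right, two_smul, two_mul]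
  rw [h3]
  refine isUnit_and_ringInverse_eq ?_ ?_ <;> rw [smul_mul_smul_comm] <;> simp [h1, h2]

theorem cayleyInv_cayley {w : J.Elem} (hw : IsUnit (2 + J.toOp w)) :
    J.cayleyInv (J.cayley w) = w := by
  apply J.toOp_injective
  rw [toOp_cayleyInv, (J.isUnit_one_sub_cayley hw).2, toOp_cayley, mul_smul_comm, smul_smul,
    mul_assoc, Ring.inverse_mul_cancel _ hw]
  simp

theorem isUnit_two_add_cayleyInv {x : J.Elem} (hx : IsUnit (1 - J.toOp x)) :
    IsUnit (2 + J.toOp (J.cayleyInv x)) ∧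
      Ring.inverse (2 + J.toOp (J.cayleyInv x)) = (2⁻¹ : ℝ) • (1 - J.toOp x) := by
  have h1 := Ring.mul_inverse_cancel _ hx
  have h2 := Ring.inverse_mul_cancel _ hx
  have h3 : 2 + J.toOp (J.cayleyInv x) = (2 : ℝ) • Ring.inverse (1 - J.toOp x) := by
    rw [toOp_cayleyInv]
    have h4 : (2 : H →L[ℂ] H) = (2 : ℝ) • 1 := by rw [two_smul, one_add_one_eq_two]
    rw [h4]
    nth_rw 1 [← h1]
    rw [← smul_add, sub_mul, one_mul, sub_add_cancel]
  rw [h3]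
  refine isUnit_and_ringInverse_eq ?_ ?_ <;> rw [smul_mul_smul_comm] <;> simp [h1, h2]

theorem cayley_cayleyInv {x : J.Elem} (hx : IsUnit (1 - J.toOp x)) :
    J.cayley (J.cayleyInv x) = x := by
  apply J.toOp_injective
  rw [toOp_cayley, (J.isUnit_two_add_cayleyInv hx).2, toOp_cayleyInv, mul_smul_comm,
    smul_mul_assoc, smul_smul, mul_assoc, Ring.inverse_mul_cancel _ hx]
  simp

variable [CompleteSpace H]

/-- Inversion is performed in `B(H)`, where it is analytic; multiplying an element of `J` by the
result is bounded bilinear into `J`. This gives analyticity for the norm of `J`, not just for the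
operator norm. -/
theorem contDiffAt_cayley {w : J.Elem} (hw : IsUnit (2 + J.toOp w)) :
    ContDiffAt ℝ ω J.cayley w := by
  obtain ⟨u, hu⟩ := hw
  have h1 : ContDiffAt ℝ ω (fun w => Ring.inverse (2 + J.toOpL w)) w := by
    have h2 : ContDiffAt ℝ ω Ring.inverse (2 + J.toOpL w) := by
      have := contDiffAt_ringInverse ℝ (n := ω) u
      rwa [hu] at this
    exact ContDiffAt.comp (f := fun w => 2 + J.toOpL w) w h2 (by fun_prop)
  exact (J.mulR.contDiff.contDiffAt.comp w h1).clm_apply contDiffAt_id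

theorem contDiffAt_cayleyInv {x : J.Elem} (hx : IsUnit (1 - J.toOp x)) :
    ContDiffAt ℝ ω J.cayleyInv x := by
  obtain ⟨u, hu⟩ := hx
  have h1 : ContDiffAt ℝ ω (fun x => Ring.inverse (1 - J.toOpL x)) x := by
    have h2 : ContDiffAt ℝ ω Ring.inverse (1 - J.toOpL x) := by
      have := contDiffAt_ringInverse ℝ (n := ω) u
      rwa [hu] at this
    exact ContDiffAt.comp (f := fun x => 1 - J.toOpL x) x h2 (by fun_prop)
  exact ((J.mulR.contDiff.contDiffAt.comp x h1).clm_apply contDiffAt_id).const_smul (2 : ℝ)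

theorem hasFDerivAt_cayleyInv_zero :
    HasFDerivAt J.cayleyInv ((2 : ℝ) • ContinuousLinearMap.id ℝ J.Elem) 0 := by
  have h0 : (1 : H →L[ℂ] H) - J.toOpL 0 = ((1 : (H →L[ℂ] H)ˣ) : H →L[ℂ] H) := by simp
  have h1 : DifferentiableAt ℝ (fun x => J.mulR (Ring.inverse (1 - J.toOpL x))) 0 := by
    refine J.mulR.differentiableAt.comp _ ?_
    have h2 : DifferentiableAt ℝ Ring.inverse ((1 : H →L[ℂ] H) - J.toOpL 0) := by
      rw [h0]
      exact (contDiffAt_ringInverse ℝ (n := ω) (1 : (H →L[ℂ] H)ˣ)).differentiableAt (by simp)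
    exact DifferentiableAt.comp (f := fun x => 1 - J.toOpL x) (0 : J.Elem) h2 (by fun_prop)
  -- In the product rule the term differentiating the inverse is applied to `0` and drops out.
  have h3 := (h1.hasFDerivAt.clm_apply (hasFDerivAt_id (0 : J.Elem))).const_smul (2 : ℝ)
  refine h3.congr_fderiv ?_
  congr 1
  rw [h0, Ring.inverse_unit]
  refine ContinuousLinearMap.ext fun x => J.toOp_injective ?_
  simp

/-- The Cayley transform as a local analytic isomorphism of `J`. -/
def cayleyHomeo : OpenPartialHomeomorph J.Elem J.Elem where
  toFun := J.cayley
  invFun := J.cayleyInv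
  source := {w | IsUnit (2 + J.toOpL w)}
  target := {x | IsUnit (1 - J.toOpL x)}
  map_source' _ hw := (J.isUnit_one_sub_cayley hw).1
  map_target' _ hx := (J.isUnit_two_add_cayleyInv hx).1
  left_inv' _ hw := J.cayleyInv_cayley hw
  right_inv' _ hx := J.cayley_cayleyInv hx
  open_source := Units.isOpen.preimage (continuous_const.add J.toOpL.continuous)
  open_target := Units.isOpen.preimage (continuous_const.sub J.toOpL.continuous)
  continuousOn_toFun _ hw := (J.contDiffAt_cayley hw).continuousAt.continuousWithinAt
  continuousOn_invFun _ hx := (J.contDiffAt_cayleyInv hx).continuousAt.continuousWithinAt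

/-- The operator `i x` is self-adjoint, so `i` is not in its spectrum. Consequently the inverse
Cayley transform is defined on the whole of `𝔲_J`. -/
theorem isUnit_one_sub_of_skew {x : H →L[ℂ] H} (hx : star x = -x) : IsUnit (1 - x) := by
  have hsa : IsSelfAdjoint (Complex.I • x) := by
    rw [isSelfAdjoint_iff, star_smul, hx]
    simp
  by_contra h
  have h1 : (1 : ℂ) ∈ spectrum ℂ x := by
    rw [spectrum.mem_iff, map_one]
    exact h
  have h2 : Complex.I ∈ spectrum ℂ (Complex.I • x) := by
    have h3 : Complex.I ∉ resolventSet ℂ (Complex.I • x) := by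
      rw [spectrum.mem_resolventSet_iff, Algebra.algebraMap_eq_smul_one, ← smul_sub]
      intro h4
      apply h
      exact (isUnit_smul_iff (Units.mk0 Complex.I Complex.I_ne_zero) _).1 h4
    exact h3
  have h3 := hsa.im_eq_zero_of_mem_spectrum h2
  simp at h3

/-! ### The slices of `U_J` and of the isotropy group -/

theorem UGroup.ext {J : SymmNormedIdeal H} {u v : J.UGroup} (h : u.toOp = v.toOp) : u = v :=
  Subtype.ext (Subtype.ext h)

theorem UGroup.subOne_injective : Function.Injective (UGroup.subOne : J.UGroup → J.Elem) :=
  fun u v h => UGroup.ext (by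
    have := congrArg J.toOp h
    exact sub_left_injective this)

theorem toOp_subOne (u : J.UGroup) : J.toOp u.subOne = u.toOp - 1 := rfl

theorem toOp_mul (u v : J.UGroup) : (u * v).toOp = u.toOp * v.toOp := rfl

theorem toOp_inv (u : J.UGroup) : (u⁻¹).toOp = star u.toOp := rfl

theorem toOp_one : (1 : J.UGroup).toOp = 1 := rfl

theorem star_toOp_mul_self (u : J.UGroup) : star u.toOp * u.toOp = 1 :=
  Unitary.star_mul_self_of_mem u.1.2

theorem toOp_mul_star_self (u : J.UGroup) : u.toOp * star u.toOp = 1 :=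
  Unitary.mul_star_self_of_mem u.1.2

theorem isEmbedding_subOne : IsEmbedding (UGroup.subOne : J.UGroup → J.Elem) :=
  ⟨⟨rfl⟩, UGroup.subOne_injective J⟩

theorem mem_isotropy_iff (a : H →L[ℂ] H) (u : J.UGroup) :
    u ∈ J.isotropy a ↔ Commute u.toOp a := by
  have h1 := J.star_toOp_mul_self u
  have h2 := J.toOp_mul_star_self u
  rw [MulAction.mem_stabilizer_iff]
  change u.toOp * a * star u.toOp = a ↔ u.toOp * a = a * u.toOp
  constructor
  · intro h
    calc u.toOp * a = u.toOp * a * star u.toOp * u.toOp := by rw [mul_assoc _ _ u.toOp, h1, mul_one]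
      _ = a * u.toOp := by rw [h]
  · intro h
    rw [h, mul_assoc, h2, mul_one]

/-- Left translation by `u ∈ U_J` in the coordinate `w` of `1 + w`. -/
def leftTranslate (u : J.UGroup) (w : J.Elem) : J.Elem := J.mulL u.toOp w + u.subOne

theorem leftTranslate_subOne (u v : J.UGroup) :
    J.leftTranslate u v.subOne = (u * v).subOne := by
  apply J.toOp_injective
  simp only [leftTranslate, map_add, toOp_mulL, toOp_subOne, toOp_mul]
  noncomm_ring

theorem leftTranslate_inv_leftTranslate (u : J.UGroup) (w : J.Elem) :
    J.leftTranslate u⁻¹ (J.leftTranslate u w) = w := by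
  apply J.toOp_injective
  simp only [leftTranslate, map_add, toOp_mulL, toOp_subOne, toOp_inv, mul_sub,
    ← mul_assoc, J.star_toOp_mul_self]
  noncomm_ring

theorem contDiff_leftTranslate (u : J.UGroup) : ContDiff ℝ ω (J.leftTranslate u) :=
  (J.mulL u.toOp).contDiff.add contDiff_const

/-- Left translation as a homeomorphism of `J`. -/
def leftTranslateHomeo (u : J.UGroup) : J.Elem ≃ₜ J.Elem where
  toFun := J.leftTranslate u
  invFun := J.leftTranslate u⁻¹
  left_inv := J.leftTranslate_inv_leftTranslate u
  right_inv w := by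
    have := J.leftTranslate_inv_leftTranslate u⁻¹ w
    rwa [inv_inv] at this
  continuous_toFun := (J.contDiff_leftTranslate u).continuous
  continuous_invFun := (J.contDiff_leftTranslate u⁻¹).continuous

/-- The ambient Cayley chart centered at `u`. -/
def cayleyChart (u : J.UGroup) : OpenPartialHomeomorph J.Elem J.Elem :=
  (J.leftTranslateHomeo u⁻¹).toOpenPartialHomeomorph.trans J.cayleyHomeo

theorem cayleyChart_apply (u : J.UGroup) (w : J.Elem) :
    J.cayleyChart u w = J.cayley (J.leftTranslate u⁻¹ w) := rfl

theorem cayleyChart_symm_apply (u : J.UGroup) (x : J.Elem) :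
    (J.cayleyChart u).symm x = J.leftTranslate u (J.cayleyInv x) := by
  change J.leftTranslate u⁻¹⁻¹ (J.cayleyInv x) = _
  rw [inv_inv]

theorem mem_cayleyChart_source {u : J.UGroup} {w : J.Elem} :
    w ∈ (J.cayleyChart u).source ↔ IsUnit (2 + J.toOp (J.leftTranslate u⁻¹ w)) := by
  simp only [cayleyChart, OpenPartialHomeomorph.trans_source]
  exact ⟨fun h => h.2, fun h => ⟨mem_univ _, h⟩⟩

theorem mem_cayleyChart_target {u : J.UGroup} {x : J.Elem} :
    x ∈ (J.cayleyChart u).target ↔ IsUnit (1 - J.toOp x) := by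
  simp only [cayleyChart, OpenPartialHomeomorph.trans_target]
  exact ⟨fun h => h.1, fun h => ⟨h, mem_univ _⟩⟩

theorem subOne_mem_cayleyChart_source (u : J.UGroup) : u.subOne ∈ (J.cayleyChart u).source := by
  rw [mem_cayleyChart_source, leftTranslate_subOne, inv_mul_cancel, toOp_subOne, toOp_one, sub_self,
    add_zero]
  have h := (isUnit_iff_ne_zero.2 (two_ne_zero : (2 : ℝ) ≠ 0)).map (algebraMap ℝ (H →L[ℂ] H))
  rwa [map_ofNat] at h

theorem contDiffOn_cayleyChart (u : J.UGroup) :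
    ContDiffOn ℝ ω (J.cayleyChart u) (J.cayleyChart u).source := fun w hw =>
  ((J.contDiffAt_cayley (J.mem_cayleyChart_source.1 hw)).comp w
    (J.contDiff_leftTranslate u⁻¹).contDiffAt).contDiffWithinAt

theorem contDiffOn_cayleyChart_symm (u : J.UGroup) :
    ContDiffOn ℝ ω (J.cayleyChart u).symm (J.cayleyChart u).target := by
  have h : ContDiffOn ℝ ω (J.leftTranslate u ∘ J.cayleyInv) (J.cayleyChart u).target :=
    fun x hx => ((J.contDiff_leftTranslate u).contDiffAt.comp x
      (J.contDiffAt_cayleyInv (J.mem_cayleyChart_target.1 hx))).contDiffWithinAt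
  exact h.congr fun x _ => J.cayleyChart_symm_apply u x

/-- The classical Cayley correspondence: `u = 1 + w` and `x = (u - 1)(u + 1)⁻¹` are related by `u =
(1 + x)(1 - x)⁻¹`, and `u* u = u u* = 1` corresponds to `x* = -x`. -/
theorem mem_range_subOne_iff {w : J.Elem} (hw : IsUnit (2 + J.toOp w)) :
    w ∈ range (UGroup.subOne : J.UGroup → J.Elem) ↔ J.cayley w ∈ J.lieAlg := by
  constructor
  · rintro ⟨u, rfl⟩
    rw [mem_lieAlg_iff, toOp_cayley]
    have h1 := J.star_toOp_mul_self u
    have h2 : (2 : H →L[ℂ] H) + J.toOp u.subOne = u.toOp + 1 := by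
      rw [toOp_subOne, ← one_add_one_eq_two]; abel
    rw [h2] at hw ⊢
    rw [toOp_subOne]
    set b := Ring.inverse (u.toOp + 1)
    have h3 : (u.toOp + 1) * b = 1 := Ring.mul_inverse_cancel _ hw
    have h4 : star b * star (u.toOp + 1) = 1 := by rw [← star_mul, h3, star_one]
    -- Both sides equal `u* - u` because `u* u = 1`; cancelling `u + 1` and its adjoint gives `x* =
    -- -x`.
    have h5 : star (u.toOp - 1) * (u.toOp + 1) = -(star (u.toOp + 1) * (u.toOp - 1)) := by
      simp only [star_sub, star_add, star_one, sub_mul, mul_add, add_mul, mul_sub, h1, one_mul,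
        mul_one]
      abel
    calc star ((u.toOp - 1) * b) = star b * (star (u.toOp - 1) * (u.toOp + 1)) * b := by
          rw [star_mul, mul_assoc, mul_assoc, h3, mul_one]
      _ = -((star b * star (u.toOp + 1)) * ((u.toOp - 1) * b)) := by
          rw [h5]; noncomm_ring
      _ = -((u.toOp - 1) * b) := by rw [h4, one_mul]
  · intro h
    rw [mem_lieAlg_iff] at h
    set x := J.cayley w with hx
    have hxu := (J.isUnit_one_sub_cayley hw).1
    rw [← hx] at hxu
    set c := Ring.inverse (1 - J.toOp x) with hc
    have h1 : (1 - J.toOp x) * c = 1 := Ring.mul_inverse_cancel _ hxu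
    have h2 : c * (1 - J.toOp x) = 1 := Ring.inverse_mul_cancel _ hxu
    have hstar : star (1 - J.toOp x) = 1 + J.toOp x := by
      rw [star_sub, h, star_one, sub_neg_eq_add]
    have h3 : star c * (1 + J.toOp x) = 1 := by rw [← hstar, ← star_mul, h1, star_one]
    have h4 : (1 + J.toOp x) * star c = 1 := by rw [← hstar, ← star_mul, h2, star_one]
    have hw' : J.toOp w = (2 : ℝ) • (J.toOp x * c) := by
      rw [← toOp_cayleyInv, hx, J.cayleyInv_cayley hw]
    have hu : 1 + J.toOp w = (1 + J.toOp x) * c := by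
      rw [hw']
      nth_rw 1 [← h1]
      rw [two_smul, sub_mul, add_mul]
      abel
    have hcomm : (1 + J.toOp x) * c = c * (1 + J.toOp x) := by
      have h5 : Commute (1 - J.toOp x) (1 + J.toOp x) :=
        ((Commute.one_right _).add_right ((Commute.one_left _).sub_left (Commute.refl _)))
      calc (1 + J.toOp x) * c = c * ((1 - J.toOp x) * (1 + J.toOp x)) * c := by
            rw [← mul_assoc, h2, one_mul]
        _ = c * (1 + J.toOp x) * ((1 - J.toOp x) * c) := by rw [h5.eq]; noncomm_ring
        _ = c * (1 + J.toOp x) := by rw [h1, mul_one]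
    have hstar' : star (1 + J.toOp x) = 1 - J.toOp x := by
      rw [star_add, h, star_one, ← sub_eq_add_neg]
    have hmem : 1 + J.toOp w ∈ unitary (H →L[ℂ] H) := by
      rw [Unitary.mem_iff]
      constructor
      · rw [hu, star_mul, hstar', hcomm]
        calc star c * (1 - J.toOp x) * (c * (1 + J.toOp x))
            = star c * ((1 - J.toOp x) * c) * (1 + J.toOp x) := by noncomm_ring
          _ = 1 := by rw [h1, mul_one, h3]
      · nth_rw 1 [hu]
        rw [hcomm, hu, star_mul, hstar']
        calc c * (1 + J.toOp x) * (star c * (1 - J.toOp x))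
            = c * ((1 + J.toOp x) * star c) * (1 - J.toOp x) := by noncomm_ring
          _ = 1 := by rw [h4, mul_one, h2]
    refine ⟨⟨⟨1 + J.toOp w, hmem⟩, ?_⟩, J.toOp_injective ?_⟩
    · change 1 + J.toOp w - 1 ∈ J.carrier
      rw [add_sub_cancel_left]
      exact J.toOp_mem w
    · change 1 + J.toOp w - 1 = J.toOp w
      rw [add_sub_cancel_left]

theorem mem_range_subOne_leftTranslate_iff (u : J.UGroup) (w : J.Elem) :
    J.leftTranslate u w ∈ range (UGroup.subOne : J.UGroup → J.Elem) ↔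
      w ∈ range (UGroup.subOne : J.UGroup → J.Elem) := by
  constructor
  · rintro ⟨v, hv⟩
    refine ⟨u⁻¹ * v, ?_⟩
    rw [← leftTranslate_subOne, hv, leftTranslate_inv_leftTranslate]
  · rintro ⟨v, rfl⟩
    exact ⟨u * v, (J.leftTranslate_subOne u v).symm⟩

/-- The Cayley charts as slice charts of `U_J ⊆ 1 + J`. -/
def unitarySlice : SliceData J.Elem J.lieAlg J.UGroup where
  ι := UGroup.subOne
  isEmbedding := J.isEmbedding_subOne
  j := J.lieAlg.subtypeL
  p := J.skewPart
  p_j := J.skewPart_coe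
  Φ := J.cayleyChart
  mem_source := J.subOne_mem_cayleyChart_source
  contDiffOn := J.contDiffOn_cayleyChart
  contDiffOn_symm := J.contDiffOn_cayleyChart_symm
  slice u w hw := by
    rw [cayleyChart_apply, ← J.mem_range_subOne_leftTranslate_iff u⁻¹,
      J.mem_range_subOne_iff (J.mem_cayleyChart_source.1 hw)]
    exact ⟨fun h => ⟨⟨_, h⟩, rfl⟩, by rintro ⟨x, hx⟩; rw [← hx]; exact x.2⟩

omit [CompleteSpace H] in
-- Each transform is a rational expression in the other, and commutants are closed under sums,
-- products and inverses.
theorem commute_cayley_iff {w : J.Elem} (hw : IsUnit (2 + J.toOp w)) (a : H →L[ℂ] H) :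
    Commute (J.toOp (J.cayley w)) a ↔ Commute (J.toOp w) a := by
  constructor
  · intro h
    rw [← J.cayleyInv_cayley hw, toOp_cayleyInv]
    refine Commute.smul_left (h.mul_left ?_) _
    exact (Commute.ringInverse_right (b := 1 - J.toOp (J.cayley w))
      ((Commute.one_right a).sub_right h.symm)).symm
  · intro h
    rw [toOp_cayley]
    refine h.mul_left ?_
    exact (Commute.ringInverse_right (b := 2 + J.toOp w)
      ((Commute.ofNat_right a 2).add_right h.symm)).symm

theorem commute_subOne_iff (u : J.UGroup) (a : H →L[ℂ] H) :
    Commute (J.toOp u.subOne) a ↔ u ∈ J.isotropy a := by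
  rw [mem_isotropy_iff, toOp_subOne]
  constructor
  · intro h
    have := h.add_left (Commute.one_left a)
    rwa [sub_add_cancel] at this
  · exact fun h => h.sub_left (Commute.one_left a)

theorem mem_range_subOne_isotropy_iff (a : H →L[ℂ] H) (w : J.Elem) :
    w ∈ range (fun u : J.isotropy a => (u : J.UGroup).subOne) ↔
      w ∈ range (UGroup.subOne : J.UGroup → J.Elem) ∧ Commute (J.toOp w) a := by
  constructor
  · rintro ⟨u, rfl⟩
    exact ⟨⟨_, rfl⟩, (J.commute_subOne_iff _ a).2 u.2⟩
  · rintro ⟨⟨u, rfl⟩, h⟩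
    exact ⟨⟨u, (J.commute_subOne_iff u a).1 h⟩, rfl⟩

/-- The Cayley charts as slice charts of the isotropy group, given a projection of `𝔲_J` onto
its Lie algebra. -/
def isotropySlice (a : H →L[ℂ] H) (P : J.lieAlg →L[ℝ] J.isotropyLieAlg a)
    (hP : ∀ x : J.isotropyLieAlg a, P x = x) :
    SliceData J.Elem (J.isotropyLieAlg a) (J.isotropy a) where
  ι u := (u : J.UGroup).subOne
  isEmbedding := J.isEmbedding_subOne.comp IsEmbedding.subtypeVal
  j := J.lieAlg.subtypeL ∘L (J.isotropyLieAlg a).subtypeL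
  p := P ∘L J.skewPart
  p_j x := (congrArg P (J.skewPart_coe x)).trans (hP x)
  Φ u := J.cayleyChart u
  mem_source u := J.subOne_mem_cayleyChart_source u
  contDiffOn u := J.contDiffOn_cayleyChart u
  contDiffOn_symm u := J.contDiffOn_cayleyChart_symm u
  slice u w hw := by
    have hw' := J.mem_cayleyChart_source.1 hw
    -- Left translation by an element of the isotropy group preserves the commutant of `a`, which
    -- reduces the question to the chart at `1`.
    have hcomm : Commute (J.toOp w) a ↔ Commute (J.toOp (J.leftTranslate (u : J.UGroup)⁻¹ w)) a := by
      have hu : Commute (u : J.UGroup).toOp a := (J.mem_isotropy_iff a u).1 u.2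
      have hu' : Commute ((u : J.UGroup)⁻¹).toOp a :=
        (J.mem_isotropy_iff a _).1 (inv_mem u.2)
      have key : ∀ (v : J.UGroup) (z : J.Elem), Commute v.toOp a → Commute (J.toOp z) a →
          Commute (J.toOp (J.leftTranslate v z)) a := by
        intro v z hv hz
        rw [leftTranslate, map_add, toOp_mulL, toOp_subOne]
        exact (hv.mul_left hz).add_left (hv.sub_left (Commute.one_left a))
      refine ⟨key _ _ hu', fun h => ?_⟩
      have h2 := key _ _ hu h
      have h3 := J.leftTranslate_inv_leftTranslate (u : J.UGroup)⁻¹ w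
      rw [inv_inv] at h3
      rwa [h3] at h2
    rw [mem_range_subOne_isotropy_iff, cayleyChart_apply,
      ← J.mem_range_subOne_leftTranslate_iff (u : J.UGroup)⁻¹, J.mem_range_subOne_iff hw', hcomm,
      ← J.commute_cayley_iff hw' a]
    constructor
    · rintro ⟨h1, h2⟩
      exact ⟨⟨⟨_, h1⟩, (J.mem_lieSet_isotropy_iff a _).2 h2⟩, rfl⟩
    · rintro ⟨x, hx⟩
      rw [← hx]
      exact ⟨x.1.2, (J.mem_lieSet_isotropy_iff a x.1).1 x.2⟩

end SymmNormedIdeal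

/-! ### Splittings by bounded projections -/

theorem isCompl_ker_of_retraction {V : Type*} [NormedAddCommGroup V] [NormedSpace ℝ V]
    {K : Submodule ℝ V} {E : V →L[ℝ] V} (hK : ∀ x, E x ∈ K) (hE : ∀ x ∈ K, E x = x) :
    IsCompl K (LinearMap.ker (E : V →ₗ[ℝ] V)) := by
  refine ⟨Submodule.disjoint_def.2 fun x hx hx' => ?_, codisjoint_iff_le_sup.2 fun x _ => ?_⟩
  · rw [← hE x hx]
    exact hx'
  · refine Submodule.mem_sup.2 ⟨E x, hK x, x - E x, ?_, by abel⟩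
    rw [LinearMap.mem_ker]
    simp [hE _ (hK x)]

/-- The splitting of a Banach space by a bounded projection `E` onto `K`. -/
def splittingOfRetraction {V : Type*} [NormedAddCommGroup V] [NormedSpace ℝ V]
    {K : Submodule ℝ V} {E : V →L[ℝ] V} (hK : ∀ x, E x ∈ K) (hE : ∀ x ∈ K, E x = x) :
    (LinearMap.ker (E : V →ₗ[ℝ] V) × K) ≃L[ℝ] V :=
  ContinuousLinearEquiv.equivOfInverse
    ((LinearMap.ker (E : V →ₗ[ℝ] V)).subtypeL.comp (ContinuousLinearMap.fst ℝ _ _) +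
      K.subtypeL.comp (ContinuousLinearMap.snd ℝ _ _))
    (((ContinuousLinearMap.id ℝ V - E).codRestrict _ fun v => by simp [hE _ (hK v)]).prod
      (E.codRestrict K hK))
    (fun x => by
      have h1 : E (x.1 : V) = 0 := x.1.2
      have h2 : E (x.2 : V) = x.2 := hE _ x.2.2
      refine Prod.ext (Subtype.ext ?_) (Subtype.ext ?_) <;> simp [h1, h2])
    (fun v => by simp)

theorem splittingOfRetraction_apply {V : Type*} [NormedAddCommGroup V] [NormedSpace ℝ V]
    {K : Submodule ℝ V} {E : V →L[ℝ] V} (hK : ∀ x, E x ∈ K) (hE : ∀ x ∈ K, E x = x)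
    (x : LinearMap.ker (E : V →ₗ[ℝ] V) × K) :
    splittingOfRetraction hK hE x = (x.1 : V) + (x.2 : V) := rfl

theorem splittingOfRetraction_mem_iff {V : Type*} [NormedAddCommGroup V] [NormedSpace ℝ V]
    {K : Submodule ℝ V} {E : V →L[ℝ] V} (hK : ∀ x, E x ∈ K) (hE : ∀ x ∈ K, E x = x)
    (x : LinearMap.ker (E : V →ₗ[ℝ] V) × K) : splittingOfRetraction hK hE x ∈ K ↔ x.1 = 0 := by
  rw [splittingOfRetraction_apply, Submodule.add_mem_iff_left _ x.2.2]
  constructor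
  · intro h
    have h1 : E (x.1 : V) = 0 := x.1.2
    exact Subtype.ext ((hE _ h).symm.trans h1)
  · intro h
    rw [h]
    exact K.zero_mem

/-! ### The Lie groups `U_J`, `U_J(a)` and the orbit -/

namespace SymmNormedIdeal

open Set Topology

variable {H : Type*} [NormedAddCommGroup H] [InnerProductSpace ℂ H] [CompleteSpace H]
  {J : SymmNormedIdeal H}

/-- A group of unitaries that is a submanifold of `1 + J` is a Lie group. -/
theorem _root_.SliceData.IsCompatible.lieGroup {S M : Type*} [NormedAddCommGroup S]
    [NormedSpace ℝ S] [TopologicalSpace M] [Group M] [ChartedSpace S M]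
    {D : SliceData J.Elem S M} (hD : D.IsCompatible) (f : M →* J.UGroup)
    (hf : ∀ m, D.ι m = (f m).subOne) : LieGroup 𝓘(ℝ, S) ω M := by
  have := hD.isManifold
  have hι := hD.contMDiff
  refine { contMDiff_mul := hD.contMDiff_of_comp ?_, contMDiff_inv := hD.contMDiff_of_comp ?_ }
  -- In the coordinate `w = u - 1`, multiplication is `w₁ + w₂ + w₁ w₂`; inversion, treated next, is
  -- the real-linear map `w ↦ w*`.
  · have h1 : ContDiff ℝ ω fun q : J.Elem × J.Elem => q.1 + q.2 + J.mulL (J.toOpL q.1) q.2 :=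
      contDiff_fst.add contDiff_snd |>.add
        ((J.mulL.contDiff.comp (J.toOpL.contDiff.comp contDiff_fst)).clm_apply contDiff_snd)
    have h2 := h1.contMDiff.comp
      ((hι.comp (contMDiff_fst (M := M) (N := M) (J := 𝓘(ℝ, S)))).prodMk_space
        (hι.comp (contMDiff_snd (M := M) (N := M) (I := 𝓘(ℝ, S)))))
    convert h2 using 1
    funext q
    refine J.toOp_injective ?_
    simp only [Function.comp_apply, hf, map_mul, map_add, toOp_mulL, toOpL_apply, toOp_subOne,
      toOp_mul]
    noncomm_ring
  · have h2 := J.starL.contDiff.contMDiff.comp hι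
    convert h2 using 1
    funext q
    refine J.toOp_injective ?_
    simp [Function.comp_apply, hf, toOp_subOne, toOp_inv]

theorem cayleyChart_one_symm (x : J.Elem) : (J.cayleyChart 1).symm x = J.cayleyInv x := by
  rw [cayleyChart_symm_apply]
  apply J.toOp_injective
  simp [leftTranslate, toOp_subOne, toOp_one]

theorem cayleyChart_one_apply_zero : J.cayleyChart 1 (UGroup.subOne 1) = 0 := by
  rw [cayleyChart_apply, leftTranslate_subOne]
  apply J.toOp_injective
  simp [toOp_cayley, toOp_subOne, toOp_one]

theorem hasFDerivAt_cayleyChart_one_symm :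
    HasFDerivAt (J.cayleyChart 1).symm ((2 : ℝ) • ContinuousLinearMap.id ℝ J.Elem)
      (J.cayleyChart 1 (UGroup.subOne 1)) := by
  rw [cayleyChart_one_apply_zero, funext (cayleyChart_one_symm (J := J))]
  exact J.hasFDerivAt_cayleyInv_zero

/-- The inclusion of the isotropy group is a split embedding. -/
theorem isSmoothEmbedding_isotropy_val {a : H →L[ℂ] H} {P : J.lieAlg →L[ℝ] J.isotropyLieAlg a}
    {hP : ∀ x : J.isotropyLieAlg a, P x = x} [ChartedSpace J.lieAlg J.UGroup]
    [ChartedSpace (J.isotropyLieAlg a) (J.isotropy a)] (hU : J.unitarySlice.IsCompatible)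
    (hI : (J.isotropySlice a P hP).IsCompatible) {F : Type _} [NormedAddCommGroup F]
    [NormedSpace ℝ F] (e : (F × J.isotropyLieAlg a) ≃L[ℝ] J.lieAlg)
    (he : ∀ x, e (0, x) = x) :
    Manifold.IsSmoothEmbedding 𝓘(ℝ, J.isotropyLieAlg a) 𝓘(ℝ, J.lieAlg) ω
      (Subtype.val : J.isotropy a → J.UGroup) := by
  refine ⟨?_, IsEmbedding.subtypeVal⟩
  refine Manifold.IsImmersionOfComplement.isImmersion (F := F) fun u => ?_
  -- Both charts restrict the same ambient Cayley chart, so in coordinates the inclusion is the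
  -- linear inclusion of the Lie algebras.
  refine Manifold.IsImmersionAtOfComplement.mk_of_charts
    ((ContinuousLinearEquiv.prodComm ℝ _ _).trans e)
    ((J.isotropySlice a P hP).chart u) (J.unitarySlice.chart u)
    ((J.isotropySlice a P hP).mem_chart_source u) (J.unitarySlice.mem_chart_source u)
    (hI.chart_mem_maximalAtlas u) (hU.chart_mem_maximalAtlas u)
    (fun _ h => h) fun x hx => ?_
  have hx' : x ∈ ((J.isotropySlice a P hP).chart u).target := by simpa using hx
  have h1 := (J.isotropySlice a P hP).ι_chart_symm hx'
  simp only [Function.comp_apply, OpenPartialHomeomorph.extend_coe,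
    OpenPartialHomeomorph.extend_coe_symm, modelWithCornersSelf_coe,
    modelWithCornersSelf_coe_symm, id]
  have h2 : J.unitarySlice.chart u (((J.isotropySlice a P hP).chart u).symm x : J.UGroup)
      = J.skewPart (J.cayleyChart u
        ((J.isotropySlice a P hP).ι (((J.isotropySlice a P hP).chart u).symm x))) := rfl
  rw [h2, h1]
  have h3 : J.cayleyChart u (((J.isotropySlice a P hP).Φ u).symm ((J.isotropySlice a P hP).j x))
      = ((x : J.lieAlg) : J.Elem) := (J.cayleyChart (u : J.UGroup)).right_inv hx'
  rw [h3, skewPart_coe]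
  exact (he x).symm

/-- In the Cayley chart the derivative at `1` is twice the inclusion, since `2 x (1 - x)⁻¹ ≈ 2 x`
near `0`; the factor does not change the range. -/
theorem range_mfderiv_subOne [ChartedSpace J.lieAlg J.UGroup] (hU : J.unitarySlice.IsCompatible) :
    Set.range (fun v : J.lieAlg =>
      (mfderiv 𝓘(ℝ, J.lieAlg) 𝓘(ℝ, J.Elem) (UGroup.subOne : J.UGroup → J.Elem) 1 v : J.Elem)) =
      (J.lieAlg : Set J.Elem) := by
  have h := (hU.hasMFDerivAt 1 (hasFDerivAt_cayleyChart_one_symm (J := J))).mfderiv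
  have h' : ∀ v : J.lieAlg, (mfderiv 𝓘(ℝ, J.lieAlg) 𝓘(ℝ, J.Elem)
      (UGroup.subOne : J.UGroup → J.Elem) 1 v : J.Elem) = (2 : ℝ) • (v : J.Elem) := fun v =>
    congrArg (fun L : J.lieAlg →L[ℝ] J.Elem => L v) h
  ext y
  constructor
  · rintro ⟨v, rfl⟩
    simp only [h']
    exact J.lieAlg.smul_mem _ v.2
  · intro hy
    exact ⟨⟨(2⁻¹ : ℝ) • y, J.lieAlg.smul_mem _ hy⟩, (h' _).trans (smul_inv_smul₀ two_ne_zero y)⟩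

theorem range_mfderiv_isotropy {a : H →L[ℂ] H} {P : J.lieAlg →L[ℝ] J.isotropyLieAlg a}
    {hP : ∀ x : J.isotropyLieAlg a, P x = x}
    [ChartedSpace (J.isotropyLieAlg a) (J.isotropy a)]
    (hI : (J.isotropySlice a P hP).IsCompatible) :
    Set.range (fun v : J.isotropyLieAlg a =>
      (mfderiv 𝓘(ℝ, J.isotropyLieAlg a) 𝓘(ℝ, J.Elem)
        (fun u : J.isotropy a => UGroup.subOne (u : J.UGroup)) 1 v : J.Elem)) =
      (Subtype.val : J.lieAlg → J.Elem) '' (J.isotropyLieAlg a : Set J.lieAlg) := by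
  have h := (hI.hasMFDerivAt 1 (hasFDerivAt_cayleyChart_one_symm (J := J))).mfderiv
  have h' : ∀ v : J.isotropyLieAlg a, (mfderiv 𝓘(ℝ, J.isotropyLieAlg a) 𝓘(ℝ, J.Elem)
      (fun u : J.isotropy a => UGroup.subOne (u : J.UGroup)) 1 v : J.Elem)
      = (2 : ℝ) • ((v : J.lieAlg) : J.Elem) := fun v =>
    congrArg (fun L : J.isotropyLieAlg a →L[ℝ] J.Elem => L v) h
  ext y
  constructor
  · rintro ⟨v, rfl⟩
    simp only [h']
    exact ⟨(2 : ℝ) • (v : J.lieAlg), (J.isotropyLieAlg a).smul_mem _ v.2, rfl⟩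
  · rintro ⟨x, hx, rfl⟩
    exact ⟨⟨(2⁻¹ : ℝ) • x, (J.isotropyLieAlg a).smul_mem _ hx⟩,
      (h' _).trans (smul_inv_smul₀ two_ne_zero (x : J.Elem))⟩

/-- The base point of the orbit. -/
def orbitBase (J : SymmNormedIdeal H) (a : H →L[ℂ] H) : J.Orbit a :=
  ⟨a, MulAction.mem_orbit_self a⟩

theorem isQuotientMap_smul_orbitBase (a : H →L[ℂ] H) :
    IsQuotientMap fun u : J.UGroup => u • J.orbitBase a :=
  ⟨⟨rfl⟩, by rintro ⟨_, u, rfl⟩; exact ⟨u, rfl⟩⟩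

theorem stabilizer_orbitBase (a : H →L[ℂ] H) :
    MulAction.stabilizer J.UGroup (J.orbitBase a) = J.isotropy a := by
  ext u
  rw [MulAction.mem_stabilizer_iff, MulAction.mem_stabilizer_iff]
  exact Subtype.ext_iff

theorem continuous_toOp : Continuous (UGroup.toOp : J.UGroup → H →L[ℂ] H) := by
  have h : (UGroup.toOp : J.UGroup → H →L[ℂ] H) = fun u => J.toOpL u.subOne + 1 := by
    funext u
    simp [toOp_subOne]
  rw [h]
  exact (J.toOpL.continuous.comp J.isEmbedding_subOne.continuous).add continuous_const

/-- The quotient topology is finer than the operator norm topology on the orbit, which is already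
Hausdorff. -/
theorem t2Space_orbit (J : SymmNormedIdeal H) (a : H →L[ℂ] H) : T2Space (J.Orbit a) := by
  have hc : Continuous fun x : J.Orbit a => (x.1 : H →L[ℂ] H) := by
    refine (isQuotientMap_smul_orbitBase a).continuous_iff.2 ?_
    have h : Continuous fun u : J.UGroup => u.toOp * a * star u.toOp :=
      ((continuous_toOp.mul continuous_const).mul continuous_toOp.star)
    exact h
  exact T2Space.of_injective_continuous (fun _ _ h => Subtype.ext h) hc

/-- The Cayley charts provide a slice for the cosets of the isotropy group. -/
theorem exists_orbitData {a : H →L[ℂ] H} {E : J.lieAlg →L[ℝ] J.lieAlg}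
    (hK : ∀ x, E x ∈ J.isotropyLieAlg a) (hE : ∀ x ∈ J.isotropyLieAlg a, E x = x)
    [ChartedSpace J.lieAlg J.UGroup] [LieGroup 𝓘(ℝ, J.lieAlg) ω J.UGroup]
    (hU : J.unitarySlice.IsCompatible) :
    ∃ D : HomogeneousData (E := J.lieAlg) (LinearMap.ker (E : J.lieAlg →ₗ[ℝ] J.lieAlg))
      (J.isotropyLieAlg a) J.UGroup (J.Orbit a), D.base = J.orbitBase a := by
  have : CompleteSpace (LinearMap.ker (E : J.lieAlg →ₗ[ℝ] J.lieAlg)) :=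
    E.isClosed_ker.completeSpace_coe
  have hunit : ∀ x : J.lieAlg, IsUnit (1 - J.toOp (x : J.Elem)) := fun x =>
    isUnit_one_sub_of_skew x.2
  obtain ⟨T⟩ := exists_cosetSlice (F := LinearMap.ker (E : J.lieAlg →ₗ[ℝ] J.lieAlg))
    (L := J.isotropyLieAlg a) (MulAction.stabilizer J.UGroup (J.orbitBase a))
    (J.unitarySlice.chart 1) (hU.chart_mem_maximalAtlas 1) (J.unitarySlice.mem_chart_source 1)
    (by
      rw [SliceData.chart_apply]
      change J.skewPart (J.cayleyChart 1 (UGroup.subOne 1)) = 0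
      rw [cayleyChart_one_apply_zero, map_zero])
    (eq_univ_of_forall fun x => J.mem_cayleyChart_target.2 (hunit x))
    (splittingOfRetraction hK hE) fun x => by
      set y := splittingOfRetraction hK hE x with hy
      have h1 : ((J.unitarySlice.chart 1).symm y).subOne = J.cayleyInv (y : J.Elem) := by
        rw [← cayleyChart_one_symm]
        exact J.unitarySlice.ι_chart_symm (J.mem_cayleyChart_target.2 (hunit y))
      -- Membership of `c(y)` in the stabilizer becomes commutation of its Cayley transform `y` with
      -- `a`, that is, vanishing of the `ker E` component of `y`.
      rw [stabilizer_orbitBase, ← commute_subOne_iff, h1,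
        ← J.commute_cayley_iff (J.isUnit_two_add_cayleyInv (hunit y)).1,
        J.cayley_cayleyInv (hunit y), ← splittingOfRetraction_mem_iff hK hE x]
      exact (J.mem_lieSet_isotropy_iff a y).symm
  exact ⟨⟨J.orbitBase a, isQuotientMap_smul_orbitBase a, T⟩, rfl⟩

end SymmNormedIdeal

end

/-! ### Assembly: expectation, Lie groups and orbit. -/

theorem mainTheorem5 {H : Type*} [NormedAddCommGroup H] [InnerProductSpace ℂ H] [CompleteSpace H]
    [TopologicalSpace.SeparableSpace H] (hH : ¬ FiniteDimensional ℂ H)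
    (J J₁ : SymmNormedIdeal H) (hJ : J.IsDualPair J₁) (a : H →L[ℂ] H) (ha : IsStarNormal a) :
    ∃ E : J.lieAlg →L[ℝ] J.lieAlg,
      -- the bounded idempotent onto the Lie algebra of the isotropy group
      (E.comp E = E ∧ LinearMap.range (E : J.lieAlg →ₗ[ℝ] J.lieAlg) = J.isotropyLieAlg a ∧
        IsCompl (J.isotropyLieAlg a) (LinearMap.ker (E : J.lieAlg →ₗ[ℝ] J.lieAlg)) ∧
        ∃ μ : lp (fun _ : ℝ × ℝ => ℂ) ∞ →L[ℂ] ℂ, IsInvariantMean μ ∧ IsAverage J J₁ a μ E) ∧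
      -- the model spaces are Banach spaces
      (CompleteSpace J.lieAlg ∧ CompleteSpace (J.isotropyLieAlg a) ∧
        CompleteSpace (LinearMap.ker (E : J.lieAlg →ₗ[ℝ] J.lieAlg))) ∧
      ∃ (_ : ChartedSpace J.lieAlg J.UGroup)
        (_ : ChartedSpace (J.isotropyLieAlg a) (J.isotropy a))
        (_ : ChartedSpace (LinearMap.ker (E : J.lieAlg →ₗ[ℝ] J.lieAlg)) (J.Orbit a)),
        -- the Banach-Lie group `U_J`, embedded in `1 + J`, with Lie algebra `𝔲_J`
        (LieGroup 𝓘(ℝ, J.lieAlg) ω J.UGroup ∧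
          Manifold.IsSmoothEmbedding 𝓘(ℝ, J.lieAlg) 𝓘(ℝ, J.Elem) ω
            (SymmNormedIdeal.UGroup.subOne : J.UGroup → J.Elem) ∧
          Set.range (fun v : J.lieAlg =>
            (mfderiv 𝓘(ℝ, J.lieAlg) 𝓘(ℝ, J.Elem)
              (SymmNormedIdeal.UGroup.subOne : J.UGroup → J.Elem) 1 v : J.Elem)) =
            (J.lieAlg : Set J.Elem)) ∧
        -- `U_J(a)` is a Banach-Lie subgroup of `U_J`, with the expected Lie algebra
        (LieGroup 𝓘(ℝ, J.isotropyLieAlg a) ω (J.isotropy a) ∧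
          Manifold.IsSmoothEmbedding 𝓘(ℝ, J.isotropyLieAlg a) 𝓘(ℝ, J.lieAlg) ω
            (Subtype.val : J.isotropy a → J.UGroup) ∧
          Set.range (fun v : J.isotropyLieAlg a =>
            (mfderiv 𝓘(ℝ, J.isotropyLieAlg a) 𝓘(ℝ, J.Elem)
              (fun u : J.isotropy a => SymmNormedIdeal.UGroup.subOne (u : J.UGroup)) 1 v :
                J.Elem)) =
            (Subtype.val : J.lieAlg → J.Elem) '' (J.isotropyLieAlg a : Set J.lieAlg)) ∧
        -- `O_J(a)` is a real-analytic homogeneous Banach manifold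
        (IsManifold 𝓘(ℝ, LinearMap.ker (E : J.lieAlg →ₗ[ℝ] J.lieAlg)) ω (J.Orbit a) ∧
          T2Space (J.Orbit a) ∧
          MulAction.IsPretransitive J.UGroup (J.Orbit a) ∧
          ContMDiffSMul 𝓘(ℝ, J.lieAlg) 𝓘(ℝ, LinearMap.ker (E : J.lieAlg →ₗ[ℝ] J.lieAlg)) ω
            J.UGroup (J.Orbit a) ∧
          Manifold.IsSubmersion 𝓘(ℝ, J.lieAlg)
            𝓘(ℝ, LinearMap.ker (E : J.lieAlg →ₗ[ℝ] J.lieAlg)) ω (J.orbitMap a)) := by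
  obtain ⟨E, hK, hE, hμ⟩ := SymmNormedIdeal.exists_expectation hJ ha
  let P : J.lieAlg →L[ℝ] J.isotropyLieAlg a := E.codRestrict (J.isotropyLieAlg a) hK
  have hP : ∀ x : J.isotropyLieAlg a, P x = x := fun x => Subtype.ext (hE x x.2)
  let csU : ChartedSpace J.lieAlg J.UGroup := J.unitarySlice.chartedSpace
  have hU : J.unitarySlice.IsCompatible := ⟨fun _ => rfl, subset_rfl⟩
  let csI : ChartedSpace (J.isotropyLieAlg a) (J.isotropy a) :=
    (J.isotropySlice a P hP).chartedSpace
  have hI : (J.isotropySlice a P hP).IsCompatible := ⟨fun _ => rfl, subset_rfl⟩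
  have lieU : LieGroup 𝓘(ℝ, J.lieAlg) ω J.UGroup := hU.lieGroup (MonoidHom.id _) fun _ => rfl
  have topU : IsTopologicalGroup J.UGroup := topologicalGroup_of_lieGroup 𝓘(ℝ, J.lieAlg) ω
  obtain ⟨D, hbase⟩ := SymmNormedIdeal.exists_orbitData hK hE hU
  have hcont : ContinuousConstSMul J.UGroup (J.Orbit a) := D.continuousConstSMul
  let csX : ChartedSpace (LinearMap.ker (E : J.lieAlg →ₗ[ℝ] J.lieAlg)) (J.Orbit a) :=
    D.chartedSpace
  have hD : D.IsCompatible := ⟨fun _ => rfl, rfl⟩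
  have hsub := hD.isSubmersionOfComplement (splittingOfRetraction hK hE)
  rw [hbase] at hsub
  refine ⟨E, ⟨?_, ?_, isCompl_ker_of_retraction hK hE, hμ⟩,
    ⟨inferInstance, inferInstance, E.isClosed_ker.completeSpace_coe⟩, csU, csI, csX,
    ⟨lieU, hU.isSmoothEmbedding, SymmNormedIdeal.range_mfderiv_subOne hU⟩,
    ⟨hI.lieGroup (J.isotropy a).subtype fun _ => rfl,
      SymmNormedIdeal.isSmoothEmbedding_isotropy_val hU hI
        (splittingOfRetraction hK hE) fun x => ?_,
      SymmNormedIdeal.range_mfderiv_isotropy hI⟩,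
    hD.isManifold, J.t2Space_orbit a, ?_, hD.contMDiffSMul,
    ⟨J.isotropyLieAlg a, inferInstance, inferInstance, hsub⟩⟩
  · exact ContinuousLinearMap.ext fun x => hE _ (hK x)
  · refine le_antisymm ?_ fun x hx => ⟨x, hE x hx⟩
    rintro _ ⟨x, rfl⟩
    exact hK x
  · rw [splittingOfRetraction_apply]
    simp
  · exact inferInstanceAs (MulAction.IsPretransitive J.UGroup (MulAction.orbit J.UGroup a))
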